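/- For $0<\sigma<1$ and a (complex-valued) Schwartz function $g$ on $\mathbb{R}^d$ consider the Neumann problem $$\partial_t^2 u+\frac{1-2\sigma}{t}\,\partial_t u=\Delta u\quad(t>0),\qquad u(\cdot,0)=0,\qquad \partial_t^\sigma u(\cdot,0)=g,$$ where $\partial_t^\sigma=\frac{1}{2\sigma}t^{1-2\sigma}\partial_t$. A solution is understood weakly in $L^2(\mathbb{R}^d)$: for every $t>0$, $u(\cdot,t)$ is continuous, belongs to $L^2(\mathbb{R}^d)$ and has $\Delta u(\cdot,t)\in L^2(\mathbb{R}^d)$ in the sense of distributions; and for every $h\in L^2(\mathbb{R}^d)$ the function $t\mapsto\langle u(\cdot,t),h\rangle$ is twice differentiable on $(0,\infty)$ and satisfies $$\Big(\partial_t^2+\frac{1-2\sigma}{t}\,\partial_t\Big)\langle u(\cdot,t),h\rangle=\langle\Delta u(\cdot,t),h\rangle\quad(t>0),\qquad \lim_{t\searrow0}\langle u(\cdot,t),h\rangle=0,\qquad \lim_{t\searrow0}\partial_t^\sigma\langle u(\cdot,t),h\rangle=\langle g,h\rangle .$$ **Theorem.** Let $d\in\{2,3,4\}$ and let $g$ be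 a Schwartz function on $\mathbb{R}^d$. For every $\sigma\in(0,1)$ the Neumann problem has exactly one such solution $u_\sigma$ on $\mathbb{R}^d\times(0,\infty)$, and for all $t>0$ and $x\in\mathbb{R}^d$ $$\lim_{\sigma}u_\sigma(x,t)=\frac{1}{c_d\,t}\int_{\partial B(x,t)}g(y)\,dS(y),$$ where $dS$ is surface measure, in each of the following cases: - $d=2$ and $\sigma\searrow0$, with $c_2=2\pi$; - $d=3$ and $\sigma\to\frac12$, with $c_3=4\pi$; - $d=4$ and $\sigma\nearrow1$, with $c_4=2\pi^2$. -/

import Mathlib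

open MeasureTheory Set Filter Topology
open scoped SchwartzMap Laplacian

noncomputable section

namespace FractionalWave

/-- The `L²` pairing `⟨f, h⟩ = ∫ f h̄` on `ℝ^d`. -/
def pairing {d : ℕ} (f h : EuclideanSpace ℝ (Fin d) → ℂ) : ℂ :=
  ∫ x, f x * (starRingEnd ℂ) (h x)

/-- `w ∈ L²` is the (distributional) Laplacian of `f ∈ L²`. That such a `w` exists says exactly
that `f` lies in the domain of the self-adjoint operator `Δ` on `L²(ℝ^d)`, and then `Δ f = w`. -/
def IsL2Laplacian {d : ℕ} (f w : EuclideanSpace ℝ (Fin d) → ℂ) : Prop :=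
  MemLp f 2 volume ∧ MemLp w 2 volume ∧
    ∀ φ : 𝓢(EuclideanSpace ℝ (Fin d), ℂ), ∫ x, f x * (Δ φ) x = ∫ x, w x * φ x

/-- The normalised time derivative `∂_t^σ F (t) = t^{1-2σ} F'(t) / (2σ)`. -/
def sigmaDeriv (σ : ℝ) (F : ℝ → ℂ) (t : ℝ) : ℂ :=
  ((1 / (2 * σ) * t ^ (1 - 2 * σ) : ℝ) : ℂ) * deriv F t

/-- `u` (of which only the values `u t x` with `t > 0` matter) solves the Neumann problem
`∂_t² u + ((1 - 2σ) / t) ∂_t u = Δ u` for `t > 0`, `u(·, 0) = 0`, `∂_t^σ u(·, 0) = g`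
weakly in `L²(ℝ^d)`. Since `u t x` is to be evaluated at points, `u t` is taken to be the
continuous representative of its `L²` class. -/
structure IsNeumannSolution {d : ℕ} (σ : ℝ) (g : EuclideanSpace ℝ (Fin d) → ℂ)
    (u : ℝ → EuclideanSpace ℝ (Fin d) → ℂ) : Prop where
  continuous : ∀ t > 0, Continuous (u t)
  memLp : ∀ t > 0, MemLp (u t) 2 volume
  /-- For every `h ∈ L²`, `t ↦ ⟨u(·, t), h⟩` is twice differentiable on `(0, ∞)`. -/
  differentiableAt : ∀ h, MemLp h 2 volume → ∀ t > 0,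
    DifferentiableAt ℝ (fun s => pairing (u s) h) t ∧
      DifferentiableAt ℝ (deriv fun s => pairing (u s) h) t
  /-- `u(·, t)` is in the domain of `Δ`, and the equation holds against every `h ∈ L²`. -/
  equation : ∀ t > 0, ∃ w, IsL2Laplacian (u t) w ∧ ∀ h, MemLp h 2 volume →
    deriv (deriv fun s => pairing (u s) h) t
      + (((1 - 2 * σ) / t : ℝ) : ℂ) * deriv (fun s => pairing (u s) h) t = pairing w h
  /-- `u(·, 0) = 0`, weakly in `L²`. -/
  initial_value : ∀ h, MemLp h 2 volume →
    Tendsto (fun t => pairing (u t) h) (𝓝[>] 0) (𝓝 0)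
  /-- `∂_t^σ u(·, 0) = g`, weakly in `L²`. -/
  initial_derivative : ∀ h, MemLp h 2 volume →
    Tendsto (fun t => sigmaDeriv σ (fun s => pairing (u s) h) t) (𝓝[>] 0) (𝓝 (pairing g h))

/-- `u` is the solution of the Neumann problem: it solves it, and any other solution coincides
with it at all positive times and all points. -/
def IsTheNeumannSolution {d : ℕ} (σ : ℝ) (g : EuclideanSpace ℝ (Fin d) → ℂ)
    (u : ℝ → EuclideanSpace ℝ (Fin d) → ℂ) : Prop :=
  IsNeumannSolution σ g u ∧ ∀ v, IsNeumannSolution σ g v → ∀ t > 0, ∀ x, v t x = u t x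

/-- The surface integral `∫_{∂B(x,t)} g dS`, by means of the surface measure of the unit sphere
(`t ^ (d - 1)` is only used for `d ≥ 1`). -/
def sphereIntegral {d : ℕ} (g : EuclideanSpace ℝ (Fin d) → ℂ) (x : EuclideanSpace ℝ (Fin d))
    (t : ℝ) : ℂ :=
  ((t ^ (d - 1) : ℝ) : ℂ) *
    ∫ ω : Metric.sphere (0 : EuclideanSpace ℝ (Fin d)) 1, g (x + t • (ω : EuclideanSpace ℝ (Fin d)))
      ∂(volume : Measure (EuclideanSpace ℝ (Fin d))).toSphere

end FractionalWave

end

/-! The Fourier transform in `x` turns the problem into an ordinary differential equation for each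
frequency. Write `K_ν` for `besselSeries ν`. The function `t^{2σ} K_{σ+1}(π²‖ξ‖²t²)` solves `F'' +
(1 - 2σ) F' / t = -(2π‖ξ‖)² F`, vanishes at `t = 0` and has `∂_t^σ F = K_σ(π²‖ξ‖²t²)`, which tends
to `1`. It is therefore the Fourier multiplier taking `g` to the solution. On the other hand,
`K_{d/2}(π²‖ξ‖²t²)` is the Fourier transform of the uniform probability measure on the sphere of
radius `t` (`integral_sphere_exp`). The indices agree when `σ + 1 = d/2`, that is `σ = 0, 1/2, 1`
for `d = 2, 3, 4`, and the Fourier formula is then a multiple of a spherical mean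
(`neumannSolution_eq_sphereIntegral`).

The limit is dominated convergence in the Fourier integral: `|K_ν| ≤ 1` on `[0, ∞)` for `ν ≥ 1/2`
(`abs_besselSeries_le_one`), and `K_ν` is continuous in `ν ≥ 1`. At `σ = 0` and `σ = 1` only the
formula is used, with no claim that it solves a Neumann problem.

For uniqueness, a solution `v` with zero data is paired with functions `h` of bounded frequency. The
functions `⟨v(t), Δ^n h⟩` form a hierarchy in which each is the singular operator applied to the
preceding one. They grow at most geometrically in `n`, whereas inverting the operator `m` times
gains a factor of order `1/m!`; hence they vanish (`eq_zero_of_hierarchy`), and such `h` suffice to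
detect `v`. -/

noncomputable section

namespace FractionalWave

/-! ### The Bessel-type power series `K_ν`: derivative, recurrence and bounds. -/

/-- The rising factorial `ν (ν + 1) ⋯ (ν + k - 1)`. -/
def risingFactorial (ν : ℝ) (k : ℕ) : ℝ := ∏ i ∈ Finset.range k, (ν + i)

lemma risingFactorial_zero (ν : ℝ) : risingFactorial ν 0 = 1 := by simp [risingFactorial]

lemma risingFactorial_succ (ν : ℝ) (k : ℕ) :
    risingFactorial ν (k + 1) = risingFactorial ν k * (ν + k) := by
  simp [risingFactorial, Finset.prod_range_succ]

lemma risingFactorial_succ_left (ν : ℝ) (k : ℕ) :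
    risingFactorial ν (k + 1) = ν * risingFactorial (ν + 1) k := by
  simp only [risingFactorial, Finset.prod_range_succ', Nat.cast_zero, add_zero, Nat.cast_add,
    Nat.cast_one, mul_comm ν]
  congr 1
  exact Finset.prod_congr rfl fun i _ => by ring

lemma risingFactorial_pos {ν : ℝ} (hν : 0 < ν) (k : ℕ) : 0 < risingFactorial ν k :=
  Finset.prod_pos fun i _ => by positivity

/-- After the first factor `ν`, every further factor is at least `1`. The bound does not depend on
`k`, so `K_ν` is dominated by an exponential series. -/
lemma min_le_risingFactorial {ν : ℝ} (hν : 0 < ν) (k : ℕ) : min 1 ν ≤ risingFactorial ν k := by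
  induction k with
  | zero => simp [risingFactorial_zero]
  | succ k ih =>
    rw [risingFactorial_succ]
    rcases k.eq_zero_or_pos with rfl | hk
    · simp [risingFactorial_zero]
    · have : (1 : ℝ) ≤ k := by exact_mod_cast hk
      nlinarith [risingFactorial_pos hν k]

/-- The terms of the power series of `besselSeries`. -/
def besselTerm (ν s : ℝ) (k : ℕ) : ℝ := (-s) ^ k / (k.factorial * risingFactorial ν k)

/-- The series `∑ (-s)^k / (k! (ν)_k)`, that is `Γ(ν) s^{(1-ν)/2} J_{ν-1}(2 √s)`. -/
def besselSeries (ν s : ℝ) : ℝ := ∑' k, besselTerm ν s k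

lemma abs_besselTerm_le {ν : ℝ} (hν : 0 < ν) (s : ℝ) (k : ℕ) :
    |besselTerm ν s k| ≤ (min 1 ν)⁻¹ * (|s| ^ k / k.factorial) := by
  have h1 := min_le_risingFactorial hν k
  have h2 : 0 < min 1 ν := lt_min one_pos hν
  rw [besselTerm, abs_div, abs_pow, abs_neg, abs_mul, Nat.abs_cast,
    abs_of_pos (risingFactorial_pos hν k), ← div_div, div_eq_inv_mul _ (risingFactorial ν k)]
  gcongr

lemma summable_besselTerm {ν : ℝ} (hν : 0 < ν) (s : ℝ) : Summable (besselTerm ν s) :=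
  Summable.of_norm_bounded ((Real.summable_pow_div_factorial |s|).mul_left _)
    (abs_besselTerm_le hν s)

lemma besselSeries_zero (ν : ℝ) : besselSeries ν 0 = 1 := by
  rw [besselSeries, tsum_eq_single 0]
  · simp [besselTerm, risingFactorial_zero]
  · intro k hk
    simp [besselTerm, hk]

lemma hasDerivAt_besselTerm_succ {ν : ℝ} (hν : 0 < ν) (s : ℝ) (k : ℕ) :
    HasDerivAt (fun s => besselTerm ν s (k + 1)) (-besselTerm (ν + 1) s k / ν) s := by
  have h := ((hasDerivAt_id s).neg.pow (k + 1)).div_const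
    ((k + 1).factorial * risingFactorial ν (k + 1))
  refine h.congr_deriv ?_
  have := (risingFactorial_pos (by positivity : 0 < ν + 1) k).ne'
  simp only [besselTerm, risingFactorial_succ_left, Nat.factorial_succ]
  push_cast
  field_simp
  simp

lemma hasDerivAt_besselSeries {ν : ℝ} (hν : 0 < ν) (s : ℝ) :
    HasDerivAt (besselSeries ν) (-besselSeries (ν + 1) s / ν) s := by
  have hν1 : 0 < ν + 1 := by positivity
  have key : HasDerivAt (fun s => ∑' k, besselTerm ν s (k + 1))
      (∑' k, -besselTerm (ν + 1) s k / ν) s := by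
    have hu : Summable fun k : ℕ => (min 1 (ν + 1))⁻¹ * ((|s| + 1) ^ k / k.factorial) / ν :=
      ((Real.summable_pow_div_factorial _).mul_left _).div_const _
    -- The derivatives are dominated uniformly on the ball of radius `|s| + 1`, which contains `s`.
    have hs : s ∈ Metric.ball (0 : ℝ) (|s| + 1) := by simp
    have hs0 : Summable fun k : ℕ => besselTerm ν s (k + 1) :=
      (summable_nat_add_iff 1).2 (summable_besselTerm hν s)
    refine hasDerivAt_tsum_of_isPreconnected hu Metric.isOpen_ball
      (convex_ball 0 (|s| + 1)).isPreconnected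
      (g := fun k s => besselTerm ν s (k + 1)) (g' := fun k s => -besselTerm (ν + 1) s k / ν)
      (fun k y _ => hasDerivAt_besselTerm_succ hν y k) ?_ hs hs0 hs
    intro k y hy
    have hy' : |y| ≤ |s| + 1 := by simpa using (Metric.mem_ball.1 hy).le
    rw [Real.norm_eq_abs, abs_div, abs_neg, abs_of_pos hν]
    have : 0 < min 1 (ν + 1) := lt_min one_pos hν1
    gcongr
    refine (abs_besselTerm_le hν1 y k).trans ?_
    gcongr
  have h0 : besselSeries ν = fun s => 1 + ∑' k, besselTerm ν s (k + 1) := by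
    funext s
    rw [besselSeries, (summable_besselTerm hν s).tsum_eq_zero_add]
    simp [besselTerm, risingFactorial_zero]
  rw [h0]
  refine (key.const_add 1).congr_deriv ?_
  rw [tsum_div_const, tsum_neg, besselSeries]

/-- Since `K_ν' = -K_{ν+1}/ν`, this is the differential equation `s K'' + ν K' + K = 0` for `K =
K_ν`. It is checked coefficient by coefficient. -/
lemma besselSeries_contiguous {ν : ℝ} (hν : 0 < ν) (s : ℝ) :
    s * besselSeries (ν + 2) s / (ν * (ν + 1)) - besselSeries (ν + 1) s + besselSeries ν s = 0 := by
  have h0 := summable_besselTerm hν s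
  have h1 := summable_besselTerm (by positivity : 0 < ν + 1) s
  have h2 := summable_besselTerm (by positivity : 0 < ν + 2) s
  have e0 := h0.tsum_eq_zero_add
  have e1 := h1.tsum_eq_zero_add
  have e : ∀ k, besselTerm (ν + 1) s (k + 1) - besselTerm ν s (k + 1) =
      s * besselTerm (ν + 2) s k / (ν * (ν + 1)) := by
    intro k
    have h3 : ν * risingFactorial (ν + 1) (k + 1) = risingFactorial ν (k + 1) * (ν + (k + 1)) := by
      rw [← risingFactorial_succ_left, risingFactorial_succ ν (k + 1)]; push_cast; ring
    have h4 : risingFactorial (ν + 1) (k + 1) = (ν + 1) * risingFactorial (ν + 2) k := by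
      rw [risingFactorial_succ_left]; norm_num [add_assoc]
    have p := risingFactorial_pos (by positivity : 0 < ν + 2) k
    have hk : 0 < ν + (k + 1) := by positivity
    have h5 : risingFactorial ν (k + 1) =
        ν * ((ν + 1) * risingFactorial (ν + 2) k) / (ν + (k + 1)) := by
      rw [eq_div_iff hk.ne', ← h3, h4]
    simp only [besselTerm, h5, h4, Nat.factorial_succ]
    push_cast
    field_simp
    ring
  have e2 := ((summable_nat_add_iff 1).2 h1).tsum_sub ((summable_nat_add_iff 1).2 h0)
  simp only [e] at e2
  rw [tsum_div_const, tsum_mul_left] at e2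
  simp only [besselTerm, risingFactorial_zero] at e0 e1
  simp only [besselSeries, e2]
  rw [show ∑' k, besselTerm ν s k = _ from e0, show ∑' k, besselTerm (ν + 1) s k = _ from e1]
  simp only [besselTerm]
  ring

lemma abs_besselSeries_le_one {ν s : ℝ} (hν : 1 / 2 ≤ ν) (hs : 0 ≤ s) :
    |besselSeries ν s| ≤ 1 := by
  have hν0 : 0 < ν := by linarith
  have hν1 : 0 < ν + 1 := by linarith
  -- This is the energy `K² + s K'²`. By the differential equation its derivative is `-(2ν - 1)
  -- K'²`, so it decreases from its value `1` at `s = 0` when `ν ≥ 1/2`.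
  let E : ℝ → ℝ := fun s => besselSeries ν s ^ 2 + s * (besselSeries (ν + 1) s / ν) ^ 2
  have hE : ∀ s, HasDerivAt E (-(2 * ν - 1) * (besselSeries (ν + 1) s / ν) ^ 2) s := by
    intro s
    have hd0 := (hasDerivAt_besselSeries hν0 s).pow 2
    have hd1 := (hasDerivAt_id s).mul (((hasDerivAt_besselSeries hν1 s).div_const ν).pow 2)
    refine (hd0.add hd1).congr_deriv ?_
    have hc := besselSeries_contiguous hν0 s
    have hc' : s * besselSeries (ν + 1 + 1) s =
        ν * (ν + 1) * (besselSeries (ν + 1) s - besselSeries ν s) := by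
      rw [show ν + 1 + 1 = ν + 2 by ring]
      field_simp at hc
      linarith
    simp only [id, Nat.cast_ofNat, one_mul]
    rw [show ∀ a b c : ℝ, s * (a * b * (-c / (ν + 1) / ν)) = a * b * (-(s * c) / (ν + 1) / ν)
      from fun a b c => by ring, hc']
    simp only [Pi.pow_apply]
    field_simp
    ring_nf
    field_simp
    ring
  have hanti : AntitoneOn E (Ici 0) := by
    refine antitoneOn_of_hasDerivWithinAt_nonpos (convex_Ici 0)
      (fun s _ => (hE s).continuousAt.continuousWithinAt) (fun s _ => (hE s).hasDerivWithinAt) ?_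
    intro s _
    nlinarith [sq_nonneg (besselSeries (ν + 1) s / ν)]
  have h := hanti (mem_Ici.2 le_rfl) (mem_Ici.2 hs) hs
  simp only [E, besselSeries_zero] at h
  rw [← sq_le_one_iff_abs_le_one]
  nlinarith [mul_nonneg hs (sq_nonneg (besselSeries (ν + 1) s / ν))]

/-- For small `ν` the series grows at most linearly. -/
lemma abs_besselSeries_le {ν s : ℝ} (hν : 0 < ν) (hs : 0 ≤ s) :
    |besselSeries ν s| ≤ 1 + s / ν := by
  -- The recurrence expresses `K_ν` through `K_{ν+1}` and `K_{ν+2}`, whose indices exceed `1/2`, so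
  -- both are bounded by `1`.
  have hc := besselSeries_contiguous hν s
  have h1 := abs_le.1 (abs_besselSeries_le_one (by linarith : 1 / 2 ≤ ν + 1) hs)
  have h2 := abs_besselSeries_le_one (by linarith : 1 / 2 ≤ ν + 2) hs
  have h3 : |s * besselSeries (ν + 2) s / (ν * (ν + 1))| ≤ s / ν := by
    rw [abs_div, abs_mul, abs_of_nonneg hs, abs_of_pos (by positivity : 0 < ν * (ν + 1)),
      div_le_div_iff₀ (by positivity) hν]
    calc s * |besselSeries (ν + 2) s| * ν ≤ s * 1 * ν := by gcongr
      _ ≤ s * (ν * (ν + 1)) := by nlinarith [mul_nonneg hs (sq_nonneg ν)]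
  have h3' := abs_le.1 h3
  rw [abs_le]
  constructor <;> linarith

lemma continuous_besselSeries {ν : ℝ} (hν : 0 < ν) : Continuous (besselSeries ν) :=
  continuous_iff_continuousAt.2 fun s => (hasDerivAt_besselSeries hν s).continuousAt

/-- For `ν ≥ 1` the majorant of the terms is independent of `ν`. With `ν = σ + 1` this range
includes the endpoint `σ = 0`. -/
lemma continuousOn_besselSeries_index (s : ℝ) :
    ContinuousOn (fun ν => besselSeries ν s) (Ici 1) := by
  have hu := Real.summable_pow_div_factorial |s|
  refine continuousOn_tsum (f := fun k ν => besselTerm ν s k) ?_ hu ?_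
  · intro k ν hν
    have hν' : (0 : ℝ) < ν := lt_of_lt_of_le one_pos hν
    have := (risingFactorial_pos hν' k).ne'
    refine ContinuousAt.continuousWithinAt ?_
    unfold besselTerm
    refine ContinuousAt.div continuousAt_const ?_ (by positivity)
    unfold risingFactorial
    fun_prop
  · intro k ν hν
    have hν' : (0 : ℝ) < ν := lt_of_lt_of_le one_pos hν
    have := abs_besselTerm_le hν' s k
    rwa [min_eq_left (mem_Ici.1 hν), inv_one, one_mul] at this

/-! ### Moments and Fourier transform of the unit sphere, computed through Gaussians. -/

section SphericalMeans

open Module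

variable {E : Type*} [NormedAddCommGroup E] [InnerProductSpace ℝ E] [FiniteDimensional ℝ E]
  [MeasurableSpace E] [BorelSpace E]

lemma integral_volumeIoiPow (n : ℕ) (f : ℝ → ℝ) :
    ∫ r : Ioi (0 : ℝ), f r ∂(Measure.volumeIoiPow n) = ∫ r in Ioi (0 : ℝ), r ^ n * f r := by
  simp only [Measure.volumeIoiPow, ENNReal.ofReal]
  rw [integral_withDensity_eq_integral_smul,
    integral_subtype_comap measurableSet_Ioi fun a ↦ Real.toNNReal (a ^ n) • f a,
    setIntegral_congr_fun measurableSet_Ioi fun x hx ↦ ?_]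
  · rw [NNReal.smul_def, Real.coe_toNNReal _ (pow_nonneg hx.out.le _), smul_eq_mul]
  · exact (measurable_subtype_coe.pow_const _).real_toNNReal

/-- The radial moment `∫₀^∞ r^m e^{-r²} dr`. -/
def radialMoment (m : ℕ) : ℝ := ∫ r in Ioi (0 : ℝ), r ^ m * Real.exp (-r ^ 2)

lemma radialMoment_eq (m : ℕ) : radialMoment m = 1 / 2 * Real.Gamma ((m + 1) / 2) := by
  have h := integral_rpow_mul_exp_neg_rpow (p := 2) (q := m) two_pos
    (by have : (0 : ℝ) ≤ m := m.cast_nonneg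
        linarith)
  rw [← h, radialMoment]
  simp [Real.rpow_natCast]

lemma radialMoment_pos (m : ℕ) : 0 < radialMoment m := by
  rw [radialMoment_eq]
  have := Real.Gamma_pos_of_pos (s := ((m : ℝ) + 1) / 2) (by positivity)
  positivity

lemma radialMoment_add_two (m : ℕ) : radialMoment (m + 2) = (m + 1) / 2 * radialMoment m := by
  have := Real.Gamma_add_one (s := ((m : ℝ) + 1) / 2) (by positivity)
  rw [radialMoment_eq, radialMoment_eq]
  push_cast
  rw [show ((m : ℝ) + 2 + 1) / 2 = (m + 1) / 2 + 1 by ring, this]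
  ring

/-- The moment of the Gaussian `e^{-‖x‖²}` in direction `ξ`. -/
def gaussianMoment (ξ : E) (n : ℕ) : ℝ := ∫ x : E, inner ℝ x ξ ^ n * Real.exp (-‖x‖ ^ 2)

/-- The moment of the unit sphere in direction `ξ`. -/
def sphereMoment (ξ : E) (n : ℕ) : ℝ :=
  ∫ ω : Metric.sphere (0 : E) 1, inner ℝ (ω : E) ξ ^ n ∂(volume : Measure E).toSphere

lemma integrable_inner_pow_mul_gaussian [Nontrivial E] (ξ : E) (n : ℕ) :
    Integrable fun x : E => inner ℝ x ξ ^ n * Real.exp (-‖x‖ ^ 2) := by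
  have h : Integrable fun x : E => ‖x‖ ^ n * Real.exp (-‖x‖ ^ 2) := by
    refine (integrable_fun_norm_addHaar volume (f := fun r => r ^ n * Real.exp (-r ^ 2))).2 ?_
    have := integrableOn_rpow_mul_exp_neg_rpow (p := 2) (s := (finrank ℝ E - 1 + n : ℕ))
      (lt_of_lt_of_le (by norm_num) (Nat.cast_nonneg _)) two_pos
    refine this.congr_fun (fun r _ => ?_) measurableSet_Ioi
    simp only [Real.rpow_natCast, smul_eq_mul, pow_add, mul_assoc]
    norm_cast
  refine (h.const_mul (‖ξ‖ ^ n)).mono' (by fun_prop) (.of_forall fun x => ?_)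
  rw [norm_mul, norm_pow, Real.norm_of_nonneg (Real.exp_pos _).le, ← mul_assoc, ← mul_pow]
  gcongr
  exact (norm_inner_le_norm x ξ).trans_eq (mul_comm _ _)

/-- Integration by parts in the direction `ξ`: the derivative of `e^{-‖x‖²}` along `ξ` is `-2⟨x, ξ⟩
e^{-‖x‖²}`. -/
lemma gaussianMoment_add_two [Nontrivial E] (ξ : E) (n : ℕ) :
    gaussianMoment ξ (n + 2) = (n + 1) / 2 * ‖ξ‖ ^ 2 * gaussianMoment ξ n := by
  have hf : ∀ x : E, HasFDerivAt (fun x : E => inner ℝ x ξ ^ (n + 1))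
      (((n + 1 : ℕ) * inner ℝ x ξ ^ n) • (innerSL ℝ ξ)) x := fun x => by
    have h1 : HasFDerivAt (fun x : E => inner ℝ x ξ) (innerSL ℝ ξ) x := by
      simpa [real_inner_comm] using (innerSL ℝ ξ).hasFDerivAt (x := x)
    simpa using h1.pow (n + 1)
  have hg : ∀ x : E, HasFDerivAt (fun x : E => Real.exp (-‖x‖ ^ 2))
      (Real.exp (-‖x‖ ^ 2) • -((2 : ℝ) • innerSL ℝ x)) x := fun x => by
    have h1 : HasFDerivAt (fun x : E => ‖x‖ ^ 2) ((2 : ℝ) • innerSL ℝ x) x := by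
      simpa [two_smul] using (HasStrictFDerivAt.hasFDerivAt (hasStrictFDerivAt_norm_sq x))
    exact h1.neg.exp
  have e1 : ∀ x : E, inner ℝ x ξ ^ (n + 1) * (fderiv ℝ (fun x : E => Real.exp (-‖x‖ ^ 2)) x) ξ =
      (-2) * (inner ℝ x ξ ^ (n + 2) * Real.exp (-‖x‖ ^ 2)) := fun x => by
    rw [(hg x).fderiv]
    simp
    ring
  have e2 : ∀ x : E, (fderiv ℝ (fun x : E => inner ℝ x ξ ^ (n + 1)) x) ξ * Real.exp (-‖x‖ ^ 2) =
      ((n + 1) * ‖ξ‖ ^ 2) * (inner ℝ x ξ ^ n * Real.exp (-‖x‖ ^ 2)) := fun x => by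
    rw [(hf x).fderiv]
    simp
    ring
  have h := integral_mul_fderiv_eq_neg_fderiv_mul_of_integrable (μ := (volume : Measure E))
    (f := fun x : E => inner ℝ x ξ ^ (n + 1)) (g := fun x : E => Real.exp (-‖x‖ ^ 2)) (v := ξ)
    (by simp only [e2]; exact (integrable_inner_pow_mul_gaussian ξ n).const_mul _)
    (by simp only [e1]; exact (integrable_inner_pow_mul_gaussian ξ (n + 2)).const_mul _)
    (integrable_inner_pow_mul_gaussian ξ (n + 1))
    (fun x _ => (hf x).differentiableAt) (fun x _ => (hg x).differentiableAt)
  simp only [e1, e2, integral_const_mul] at h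
  simp only [gaussianMoment]
  linarith

lemma gaussianMoment_one (ξ : E) : gaussianMoment ξ 1 = 0 := by
  have h := integral_neg_eq_self (fun x : E => inner ℝ x ξ ^ 1 * Real.exp (-‖x‖ ^ 2)) volume
  simp only [inner_neg_left, pow_one, norm_neg, neg_mul, integral_neg] at h
  simp only [gaussianMoment, pow_one]
  linarith

/-- In polar coordinates the integrand splits into an angular and a radial factor. -/
lemma gaussianMoment_eq_sphereMoment_mul [Nontrivial E] (ξ : E) (n : ℕ) :
    gaussianMoment ξ n = sphereMoment ξ n * radialMoment (finrank ℝ E - 1 + n) := by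
  let F : E → ℝ := fun x => inner ℝ x ξ ^ n * Real.exp (-‖x‖ ^ 2)
  calc gaussianMoment ξ n = ∫ x : ({(0)}ᶜ : Set E), F x ∂((volume : Measure E).comap (↑)) := by
        rw [integral_subtype_comap (measurableSet_singleton _).compl F, restrict_compl_singleton]
        rfl
    _ = ∫ p : Metric.sphere (0 : E) 1 × Ioi (0 : ℝ), F ((p.2 : ℝ) • (p.1 : E))
          ∂(volume : Measure E).toSphere.prod (.volumeIoiPow (finrank ℝ E - 1)) := by
        rw [← (volume : Measure E).measurePreserving_homeomorphUnitSphereProd.integral_comp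
          (Homeomorph.measurableEmbedding _)
          (fun p : Metric.sphere (0 : E) 1 × Ioi (0 : ℝ) => F ((p.2 : ℝ) • (p.1 : E)))]
        refine integral_congr_ae (.of_forall fun x => ?_)
        have := congrArg Subtype.val ((homeomorphUnitSphereProd E).symm_apply_apply x)
        rw [homeomorphUnitSphereProd_symm_apply_coe] at this
        simp only [this]
    _ = ∫ p : Metric.sphere (0 : E) 1 × Ioi (0 : ℝ), inner ℝ (p.1 : E) ξ ^ n *
          ((p.2 : ℝ) ^ n * Real.exp (-(p.2 : ℝ) ^ 2))
          ∂(volume : Measure E).toSphere.prod (.volumeIoiPow (finrank ℝ E - 1)) := by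
        refine integral_congr_ae (.of_forall fun p => ?_)
        have h1 : ‖(p.1 : E)‖ = 1 := by simp
        have h2 : (0 : ℝ) < p.2 := p.2.2
        simp only [F, inner_smul_left, norm_smul, h1, Real.norm_of_nonneg h2.le, mul_one, mul_pow]
        simp
        ring
    _ = sphereMoment ξ n * ∫ r : Ioi (0 : ℝ), (r : ℝ) ^ n * Real.exp (-(r : ℝ) ^ 2)
          ∂(.volumeIoiPow (finrank ℝ E - 1)) :=
        integral_prod_mul (fun ω : Metric.sphere (0 : E) 1 => inner ℝ (ω : E) ξ ^ n)
          (fun r : Ioi (0 : ℝ) => (r : ℝ) ^ n * Real.exp (-(r : ℝ) ^ 2))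
    _ = _ := by
        rw [integral_volumeIoiPow _ (fun r => r ^ n * Real.exp (-r ^ 2)), radialMoment]
        simp only [pow_add, mul_assoc]

/-- Dividing the Gaussian recurrence by the radial one, whose factor is `(n + d)/2`, leaves a
recurrence on the sphere. -/
lemma sphereMoment_add_two [Nontrivial E] (ξ : E) (n : ℕ) :
    sphereMoment ξ (n + 2) = (n + 1) / (n + finrank ℝ E) * ‖ξ‖ ^ 2 * sphereMoment ξ n := by
  have h := gaussianMoment_add_two ξ n
  rw [gaussianMoment_eq_sphereMoment_mul, gaussianMoment_eq_sphereMoment_mul, ← add_assoc,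
    radialMoment_add_two] at h
  have hd : 0 < finrank ℝ E := finrank_pos
  have hR := (radialMoment_pos (finrank ℝ E - 1 + n)).ne'
  have hc : ((finrank ℝ E - 1 + n : ℕ) : ℝ) + 1 = n + finrank ℝ E := by
    have : finrank ℝ E - 1 + n + 1 = n + finrank ℝ E := by omega
    exact_mod_cast this
  have hp : (0 : ℝ) < n + finrank ℝ E := by positivity
  rw [hc] at h
  have h' : sphereMoment ξ (n + 2) * (n + finrank ℝ E) =
      (n + 1) * ‖ξ‖ ^ 2 * sphereMoment ξ n :=
    mul_right_cancel₀ hR (by linear_combination 2 * h)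
  field_simp
  linarith

lemma sphereMoment_odd [Nontrivial E] (ξ : E) (k : ℕ) : sphereMoment ξ (2 * k + 1) = 0 := by
  induction k with
  | zero =>
    have h := gaussianMoment_eq_sphereMoment_mul ξ 1
    rw [gaussianMoment_one] at h
    simpa [(radialMoment_pos _).ne'] using h.symm
  | succ k ih =>
    rw [show 2 * (k + 1) + 1 = 2 * k + 1 + 2 by ring, sphereMoment_add_two, ih, mul_zero]

/-- From `k` to `k + 1` both sides are multiplied by `-z²‖ξ‖² / ((2k + 2)(2k + d))`. -/
lemma sphereMoment_even [Nontrivial E] (ξ : E) (z : ℝ) (k : ℕ) :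
    (-z ^ 2) ^ k * sphereMoment ξ (2 * k) / (2 * k).factorial =
      (volume : Measure E).toSphere.real univ *
        besselTerm (finrank ℝ E / 2) (z ^ 2 * ‖ξ‖ ^ 2 / 4) k := by
  induction k with
  | zero => simp [sphereMoment, besselTerm, risingFactorial_zero]
  | succ k ih =>
    have hd : (0 : ℝ) < finrank ℝ E := by exact_mod_cast finrank_pos
    have hp := risingFactorial_pos (half_pos hd) k
    have e1 : besselTerm (finrank ℝ E / 2) (z ^ 2 * ‖ξ‖ ^ 2 / 4) (k + 1) =
        besselTerm (finrank ℝ E / 2) (z ^ 2 * ‖ξ‖ ^ 2 / 4) k * (-z ^ 2 * ‖ξ‖ ^ 2 /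
          ((2 * k + 2) * (2 * k + finrank ℝ E))) := by
      simp only [besselTerm, risingFactorial_succ, Nat.factorial_succ, pow_succ]
      push_cast
      field_simp
      ring
    rw [e1, ← mul_assoc, ← ih, show 2 * (k + 1) = 2 * k + 2 by ring, sphereMoment_add_two,
      Nat.factorial_succ, Nat.factorial_succ]
    push_cast
    field_simp
    ring

/-- The Fourier transform of the surface measure of the unit sphere. -/
lemma integral_sphere_exp [Nontrivial E] (ξ : E) (z : ℝ) :
    ∫ ω : Metric.sphere (0 : E) 1, Complex.exp ((z * inner ℝ (ω : E) ξ : ℝ) * Complex.I)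
        ∂(volume : Measure E).toSphere =
      (((volume : Measure E).toSphere.real univ *
        besselSeries (finrank ℝ E / 2) (z ^ 2 * ‖ξ‖ ^ 2 / 4) : ℝ) : ℂ) := by
  have hd : (0 : ℝ) < finrank ℝ E := by exact_mod_cast finrank_pos
  have hbound : Summable fun n : ℕ => (|z| * ‖ξ‖) ^ n / n.factorial :=
    Real.summable_pow_div_factorial _
  -- The exponential series is integrated term by term. The odd moments vanish and the even ones are
  -- the terms of `K_{d/2}`.
  have h1 := hasSum_integral_of_dominated_convergence (μ := (volume : Measure E).toSphere)
    (F := fun (n : ℕ) (ω : Metric.sphere (0 : E) 1) =>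
      ((z * inner ℝ (ω : E) ξ : ℝ) * Complex.I) ^ n / n.factorial)
    (f := fun ω => Complex.exp ((z * inner ℝ (ω : E) ξ : ℝ) * Complex.I))
    (fun n _ => (|z| * ‖ξ‖) ^ n / n.factorial)
    (fun n => Continuous.aestronglyMeasurable (by fun_prop))
    (fun n => .of_forall fun ω => by
      rw [norm_div, norm_pow, norm_mul, Complex.norm_I, mul_one, Complex.norm_real, norm_mul,
        Complex.norm_natCast, Real.norm_eq_abs]
      have := norm_inner_le_norm (𝕜 := ℝ) (ω : E) ξ
      rw [norm_eq_of_mem_sphere, one_mul] at this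
      gcongr)
    (.of_forall fun _ => hbound) (integrable_const _)
    (.of_forall fun ω => by
      rw [Complex.exp_eq_exp_ℂ]
      exact NormedSpace.expSeries_div_hasSum_exp _)
  have h2 : ∀ n : ℕ, ∫ ω : Metric.sphere (0 : E) 1,
      ((z * inner ℝ (ω : E) ξ : ℝ) * Complex.I) ^ n / n.factorial
        ∂(volume : Measure E).toSphere =
      (z * Complex.I) ^ n * (sphereMoment ξ n : ℝ) / n.factorial := fun n => by
    rw [sphereMoment, ← integral_complex_ofReal, ← integral_const_mul, ← integral_div]
    refine integral_congr_ae (.of_forall fun ω => ?_)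
    push_cast
    ring
  simp only [h2] at h1
  have h3 : HasSum (fun k : ℕ => (((volume : Measure E).toSphere.real univ *
      besselTerm (finrank ℝ E / 2) (z ^ 2 * ‖ξ‖ ^ 2 / 4) k : ℝ) : ℂ))
      (((volume : Measure E).toSphere.real univ *
        besselSeries (finrank ℝ E / 2) (z ^ 2 * ‖ξ‖ ^ 2 / 4) : ℝ) : ℂ) :=
    Complex.hasSum_ofReal.2 (((summable_besselTerm (half_pos hd) _).hasSum).mul_left _)
  have h4 := HasSum.even_add_odd
    (f := fun n : ℕ => (z * Complex.I) ^ n * (sphereMoment ξ n : ℝ) / (n.factorial : ℂ))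
    (m := (((volume : Measure E).toSphere.real univ *
        besselSeries (finrank ℝ E / 2) (z ^ 2 * ‖ξ‖ ^ 2 / 4) : ℝ) : ℂ)) (m' := 0)
    (by
      convert h3 using 2 with k
      rw [← sphereMoment_even, pow_mul, mul_pow, Complex.I_sq]
      push_cast
      ring)
    (by simp [sphereMoment_odd])
  rw [add_zero] at h4
  exact h1.unique h4

end SphericalMeans

/-! ### The Fourier transform on `L²` and the distributional Laplacian. -/

section FourierL2

open scoped FourierTransform ContDiff InnerProductSpace

/-- The Fourier symbol of the Laplacian. -/
def laplaceSymbol {E : Type*} [NormedAddCommGroup E] (ξ : E) : ℂ :=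
  ((-(2 * Real.pi) ^ 2 * ‖ξ‖ ^ 2 : ℝ) : ℂ)

lemma laplaceSymbol_neg {E : Type*} [NormedAddCommGroup E] (ξ : E) :
    laplaceSymbol (-ξ) = laplaceSymbol ξ := by
  simp [laplaceSymbol]

lemma continuous_laplaceSymbol {E : Type*} [NormedAddCommGroup E] :
    Continuous (laplaceSymbol : E → ℂ) := by
  unfold laplaceSymbol
  fun_prop

lemma hasTemperateGrowth_laplaceSymbol {E : Type*} [NormedAddCommGroup E]
    [InnerProductSpace ℝ E] : (laplaceSymbol : E → ℂ).HasTemperateGrowth := by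
  unfold laplaceSymbol
  fun_prop

variable {E : Type*} [NormedAddCommGroup E] [InnerProductSpace ℝ E] [FiniteDimensional ℝ E]
  [MeasurableSpace E] [BorelSpace E]

lemma ae_eq_of_forall_integral_mul_schwartz {f g : E → ℂ} (hf : LocallyIntegrable f)
    (hg : LocallyIntegrable g) (h : ∀ φ : 𝓢(E, ℂ), ∫ x, f x * φ x = ∫ x, g x * φ x) :
    f =ᵐ[volume] g := by
  refine ae_eq_of_integral_contDiff_smul_eq hf hg fun p p_smooth p_cpt => ?_
  have hg₁ : HasCompactSupport (Complex.ofRealCLM ∘ p) := p_cpt.comp_left rfl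
  have hg₂ : ContDiff ℝ ∞ (Complex.ofRealCLM ∘ p) := by fun_prop
  simpa [mul_comm] using h (hg₁.toSchwartzMap hg₂)

/-- The inverse transform on `L²` is compatible with the one on tempered distributions, which is
defined by duality. -/
lemma integral_lp_fourierInv_mul_schwartz (f : Lp ℂ 2 (volume : Measure E)) (φ : 𝓢(E, ℂ)) :
    ∫ x, (𝓕⁻ f : Lp ℂ 2 (volume : Measure E)) x * φ x = ∫ x, f x * (𝓕⁻ φ) x := by
  have h := congrArg (fun T : 𝓢'(E, ℂ) => T φ) (Lp.fourierInv_toTemperedDistribution_eq f)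
  simp only [TemperedDistribution.fourierInv_apply, Lp.toTemperedDistribution_apply,
    smul_eq_mul] at h
  simp only [mul_comm _ (φ _), mul_comm _ ((𝓕⁻ φ) _)]
  exact h.symm

lemma continuous_fourierInv_of_integrable {f : E → ℂ} (hf : Integrable f) :
    Continuous (𝓕⁻ f : E → ℂ) := by
  have h : Continuous (𝓕 f : E → ℂ) := by
    have := VectorFourier.fourierIntegral_continuous Real.continuous_fourierChar
      (L := innerₗ E) (by exact continuous_inner) hf
    exact this
  have e : (𝓕⁻ f : E → ℂ) = fun x => 𝓕 f (-x) := by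
    funext x
    exact Real.fourierInv_eq_fourier_neg f x
  rw [e]
  exact h.comp continuous_neg

lemma integral_fourierInv_mul_schwartz {f : E → ℂ} (hf : Integrable f) (φ : 𝓢(E, ℂ)) :
    ∫ x, (𝓕⁻ f : E → ℂ) x * φ x = ∫ x, f x * (𝓕⁻ φ) x := by
  have h := VectorFourier.integral_fourierIntegral_smul_eq_flip (μ := (volume : Measure E))
    (ν := (volume : Measure E)) (L := innerₗ E) Real.continuous_fourierChar
    (by exact continuous_inner) hf.comp_neg φ.integrable
  rw [flip_innerₗ] at h
  have h' : ∫ x, 𝓕 (fun y => f (-y)) x * φ x = ∫ x, f (-x) * 𝓕 (φ : E → ℂ) x := h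
  rw [← Real.fourierInv_eq_fourier_comp_neg] at h'
  rw [h', ← integral_neg_eq_self]
  refine integral_congr_ae (.of_forall fun x => ?_)
  simp only [neg_neg, SchwartzMap.fourierInv_coe, Real.fourierInv_eq_fourier_neg]

/-- On `L¹ ∩ L²`, the inverse Fourier integral represents the inverse Fourier transform of `L²`. -/
lemma lp_fourierInv_toLp_ae_eq {f : E → ℂ} (hf : Integrable f) (hf2 : MemLp f 2 volume) :
    (𝓕⁻ (hf2.toLp f) : Lp ℂ 2 (volume : Measure E)) =ᵐ[volume] (𝓕⁻ f : E → ℂ) := by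
  refine ae_eq_of_forall_integral_mul_schwartz
    ((Lp.memLp _).locallyIntegrable one_le_two)
    (continuous_fourierInv_of_integrable hf).locallyIntegrable fun φ => ?_
  rw [integral_lp_fourierInv_mul_schwartz, integral_fourierInv_mul_schwartz hf]
  refine integral_congr_ae ?_
  filter_upwards [hf2.coeFn_toLp] with x hx
  rw [hx]

lemma memLp_fourierInv {f : E → ℂ} (hf : Integrable f) (hf2 : MemLp f 2 volume) :
    MemLp (𝓕⁻ f : E → ℂ) 2 volume :=
  (Lp.memLp _).ae_eq (lp_fourierInv_toLp_ae_eq hf hf2)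

lemma toLp_fourierInv {f : E → ℂ} (hf : Integrable f) (hf2 : MemLp f 2 volume) :
    (memLp_fourierInv hf hf2).toLp (𝓕⁻ f : E → ℂ) = 𝓕⁻ (hf2.toLp f) := by
  refine Lp.ext ((MemLp.coeFn_toLp _).trans (lp_fourierInv_toLp_ae_eq hf hf2).symm)

lemma fourier_laplacian_apply (φ : 𝓢(E, ℂ)) (ξ : E) :
    (𝓕 (Δ φ)) ξ = laplaceSymbol ξ * (𝓕 φ) ξ := by
  have h2 : (fun x : E => ‖x‖ ^ 2).HasTemperateGrowth := by fun_prop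
  rw [SchwartzMap.laplacian_eq_fourierMultiplierCLM, SchwartzMap.fourierMultiplierCLM_apply]
  rw [FourierTransform.fourier_smul, FourierTransform.fourier_fourierInv_eq,
    smul_apply, SchwartzMap.smulLeftCLM_apply_apply h2]
  simp [laplaceSymbol]
  ring

lemma fourierInv_laplacian_apply (φ : 𝓢(E, ℂ)) (ξ : E) :
    (𝓕⁻ (Δ φ)) ξ = laplaceSymbol ξ * (𝓕⁻ φ) ξ := by
  have h := fourier_laplacian_apply φ (-ξ)
  rw [laplaceSymbol_neg] at h
  rw [SchwartzMap.fourierInv_coe, SchwartzMap.fourierInv_coe, Real.fourierInv_eq_fourier_neg,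
    Real.fourierInv_eq_fourier_neg, ← SchwartzMap.fourier_coe, ← SchwartzMap.fourier_coe, h]

variable {d : ℕ}

lemma pairing_eq_inner {f h : EuclideanSpace ℝ (Fin d) → ℂ} (hf : MemLp f 2 volume)
    (hh : MemLp h 2 volume) : pairing f h = ⟪hh.toLp h, hf.toLp f⟫_ℂ := by
  rw [L2.inner_def]
  refine integral_congr_ae ?_
  filter_upwards [hf.coeFn_toLp, hh.coeFn_toLp] with x hx hx'
  rw [hx, hx']
  simp

lemma pairing_fourierInv {f h : EuclideanSpace ℝ (Fin d) → ℂ} (hf : Integrable f)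
    (hf2 : MemLp f 2 volume) (hh : MemLp h 2 volume) :
    pairing (𝓕⁻ f) h =
      ∫ ξ, f ξ * (starRingEnd ℂ) ((𝓕 (hh.toLp h) : Lp ℂ 2 (volume : Measure _)) ξ) := by
  rw [pairing_eq_inner (memLp_fourierInv hf hf2) hh, toLp_fourierInv hf hf2,
    ← Lp.inner_fourier_eq, FourierTransform.fourier_fourierInv_eq, L2.inner_def]
  refine integral_congr_ae ?_
  filter_upwards [hf2.coeFn_toLp] with x hx
  rw [hx]
  simp

lemma isL2Laplacian_fourierInv {f : EuclideanSpace ℝ (Fin d) → ℂ} (hf : Integrable f)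
    (hf2 : MemLp f 2 volume)
    (hw : Integrable fun ξ => laplaceSymbol ξ * f ξ)
    (hw2 : MemLp (fun ξ => laplaceSymbol ξ * f ξ) 2 volume) :
    IsL2Laplacian (𝓕⁻ f)
      (𝓕⁻ fun ξ => laplaceSymbol ξ * f ξ) := by
  refine ⟨memLp_fourierInv hf hf2, memLp_fourierInv hw hw2, fun φ => ?_⟩
  rw [integral_fourierInv_mul_schwartz hf, integral_fourierInv_mul_schwartz hw]
  refine integral_congr_ae (.of_forall fun ξ => ?_)
  simp only [fourierInv_laplacian_apply]
  ring

/-- Testing the definition against `𝓕⁻ φ` works because `Δ (𝓕⁻ φ)` is the inverse transform of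
`laplaceSymbol` times `φ`. The right-hand side is at first only known to be locally integrable,
which is enough to identify functions by Schwartz tests. -/
lemma IsL2Laplacian.fourierInv_ae_eq {v w : EuclideanSpace ℝ (Fin d) → ℂ}
    (h : IsL2Laplacian v w) :
    (𝓕⁻ (h.2.1.toLp w) : Lp ℂ 2 (volume : Measure (EuclideanSpace ℝ (Fin d)))) =ᵐ[volume]
      fun ξ => laplaceSymbol ξ *
        (𝓕⁻ (h.1.toLp v) : Lp ℂ 2 (volume : Measure (EuclideanSpace ℝ (Fin d)))) ξ := by
  have hloc := (Lp.memLp (𝓕⁻ (h.1.toLp v) : Lp ℂ 2 (volume :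
    Measure (EuclideanSpace ℝ (Fin d))))).locallyIntegrable one_le_two
  refine ae_eq_of_forall_integral_mul_schwartz
    ((Lp.memLp _).locallyIntegrable one_le_two) ?_ fun φ => ?_
  · have := (hloc.locallyIntegrableOn univ).continuousOn_mul
      (continuous_laplaceSymbol (E := EuclideanSpace ℝ (Fin d))).continuousOn
      isOpen_univ.isLocallyClosed
    exact locallyIntegrableOn_univ.1 this
  · have e : Δ (𝓕⁻ φ) = 𝓕⁻ (SchwartzMap.smulLeftCLM ℂ laplaceSymbol φ) := by
      rw [← FourierTransform.fourierInv_fourier_eq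
        (F := 𝓢(EuclideanSpace ℝ (Fin d), ℂ)) (Δ (𝓕⁻ φ))]
      congr 1
      ext ξ
      rw [fourier_laplacian_apply, FourierTransform.fourier_fourierInv_eq,
        SchwartzMap.smulLeftCLM_apply_apply hasTemperateGrowth_laplaceSymbol, smul_eq_mul]
    have h1 := integral_lp_fourierInv_mul_schwartz (h.1.toLp v)
      (SchwartzMap.smulLeftCLM ℂ laplaceSymbol φ)
    have h2 := h.2.2 (𝓕⁻ φ)
    rw [e] at h2
    have e1 : ∀ {f : EuclideanSpace ℝ (Fin d) → ℂ} (hf : MemLp f 2 volume)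
        (ψ : 𝓢(EuclideanSpace ℝ (Fin d), ℂ)), ∫ x, hf.toLp f x * ψ x = ∫ x, f x * ψ x :=
      fun hf ψ => by
        refine integral_congr_ae ?_
        filter_upwards [hf.coeFn_toLp] with x hx
        rw [hx]
    rw [integral_lp_fourierInv_mul_schwartz, e1, ← h2, ← e1 h.1, ← h1]
    refine integral_congr_ae (.of_forall fun ξ => ?_)
    simp only [SchwartzMap.smulLeftCLM_apply_apply hasTemperateGrowth_laplaceSymbol, smul_eq_mul]
    ring

end FourierL2

/-! ### Existence: the Fourier multiplier and differentiation under the integral. -/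

section Existence

open scoped FourierTransform

/-- The solution `t ^ (2σ) K_{σ+1}(c t²)` of `F'' + (1 - 2σ) F' / t + 4 c F = 0`. -/
def timeFactor (σ c t : ℝ) : ℝ := t ^ (2 * σ) * besselSeries (σ + 1) (c * t ^ 2)

/-- The time derivative of `timeFactor`. -/
def timeFactorDeriv (σ c t : ℝ) : ℝ := 2 * σ * t ^ (2 * σ - 1) * besselSeries σ (c * t ^ 2)

/-- The product rule gives a combination of `K_{σ+1}` and `K_{σ+2}`, which the recurrence collapses
to the single series `K_σ`. -/
lemma hasDerivAt_timeFactor {σ c t : ℝ} (hσ : 0 < σ) (ht : 0 < t) :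
    HasDerivAt (timeFactor σ c) (timeFactorDeriv σ c t) t := by
  have hσ1 : 0 < σ + 1 := by positivity
  have h1 : HasDerivAt (fun t => t ^ (2 * σ)) (2 * σ * t ^ (2 * σ - 1)) t :=
    Real.hasDerivAt_rpow_const (Or.inl ht.ne')
  have h2 : HasDerivAt (fun t => c * t ^ 2) (c * (2 * t)) t := by
    simpa using ((hasDerivAt_id t).pow 2).const_mul c
  have h3 := (hasDerivAt_besselSeries hσ1 (c * t ^ 2)).comp t h2
  refine (h1.mul h3).congr_deriv ?_
  have hc := besselSeries_contiguous hσ (c * t ^ 2)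
  have e : t ^ (2 * σ) = t ^ (2 * σ - 1) * t := by
    rw [← Real.rpow_add_one ht.ne', sub_add_cancel]
  have hK : besselSeries σ (c * t ^ 2) = besselSeries (σ + 1) (c * t ^ 2) -
      c * t ^ 2 * besselSeries (σ + 2) (c * t ^ 2) / (σ * (σ + 1)) := by linarith
  rw [timeFactorDeriv, hK, e, show σ + 1 + 1 = σ + 2 by ring]
  simp only [Function.comp]
  field_simp
  ring

/-- Differentiating `K_σ` brings back `K_{σ+1}`, and with it the original function. For `c = π²‖ξ‖²`
the coefficient `4c` is minus the symbol of the Laplacian. -/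
lemma hasDerivAt_timeFactorDeriv {σ c t : ℝ} (hσ : 0 < σ) (ht : 0 < t) :
    HasDerivAt (timeFactorDeriv σ c)
      (-(1 - 2 * σ) / t * timeFactorDeriv σ c t - 4 * c * timeFactor σ c t) t := by
  have h1 : HasDerivAt (fun t => t ^ (2 * σ - 1)) ((2 * σ - 1) * t ^ (2 * σ - 1 - 1)) t :=
    Real.hasDerivAt_rpow_const (Or.inl ht.ne')
  have h2 : HasDerivAt (fun t => c * t ^ 2) (c * (2 * t)) t := by
    simpa using ((hasDerivAt_id t).pow 2).const_mul c
  have h3 := (hasDerivAt_besselSeries hσ (c * t ^ 2)).comp t h2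
  refine ((h1.const_mul (2 * σ)).mul h3).congr_deriv ?_
  have e : t ^ (2 * σ) = t ^ (2 * σ - 1) * t := by
    rw [← Real.rpow_add_one ht.ne', sub_add_cancel]
  have e' : t ^ (2 * σ - 1 - 1) = t ^ (2 * σ - 1) / t := Real.rpow_sub_one ht.ne' _
  rw [timeFactorDeriv, timeFactor, e, e']
  simp only [Function.comp]
  field_simp
  ring

lemma abs_timeFactor_le {σ c t : ℝ} (hσ : 0 < σ) (hc : 0 ≤ c) (ht : 0 ≤ t) :
    |timeFactor σ c t| ≤ t ^ (2 * σ) := by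
  rw [timeFactor, abs_mul, abs_of_nonneg (Real.rpow_nonneg ht _)]
  exact mul_le_of_le_one_right (Real.rpow_nonneg ht _)
    (abs_besselSeries_le_one (by linarith) (by positivity))

lemma abs_timeFactorDeriv_le {σ c t : ℝ} (hσ : 0 < σ) (hc : 0 ≤ c) (ht : 0 ≤ t) :
    |timeFactorDeriv σ c t| ≤ 2 * σ * t ^ (2 * σ - 1) * (1 + c * t ^ 2 / σ) := by
  have h := Real.rpow_nonneg ht (2 * σ - 1)
  rw [timeFactorDeriv, abs_mul, abs_of_nonneg (by positivity : 0 ≤ 2 * σ * t ^ (2 * σ - 1))]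
  gcongr
  exact abs_besselSeries_le hσ (by positivity)

variable {E : Type*} [NormedAddCommGroup E] [MeasurableSpace E]

/-- Differentiation under the integral sign against a fixed weight `G`, for a family that grows at
most quadratically in the frequency, locally uniformly in time. -/
lemma hasDerivAt_integral_mul_of_quadratic_bound {μ : Measure E} {φ φ' : ℝ → E → ℝ} {b : ℝ → ℝ}
    {G : E → ℂ} (hb : ContinuousOn b (Ioi 0))
    (hφ : ∀ t > 0, AEStronglyMeasurable (φ t) μ) (hφ' : ∀ t > 0, AEStronglyMeasurable (φ' t) μ)
    (hφb : ∀ t > 0, ∀ ξ, |φ t ξ| ≤ b t * (1 + ‖ξ‖ ^ 2))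
    (hφb' : ∀ t > 0, ∀ ξ, |φ' t ξ| ≤ b t * (1 + ‖ξ‖ ^ 2))
    (hd : ∀ t > 0, ∀ ξ, HasDerivAt (fun s => φ s ξ) (φ' t ξ) t)
    (hG : AEStronglyMeasurable G μ) (hGi : Integrable (fun ξ => (1 + ‖ξ‖ ^ 2) * ‖G ξ‖) μ)
    {t : ℝ} (ht : 0 < t) :
    HasDerivAt (fun s => ∫ ξ, (φ s ξ : ℂ) * G ξ ∂μ) (∫ ξ, (φ' t ξ : ℂ) * G ξ ∂μ) t := by
  have hmeas : ∀ {ψ : E → ℝ}, AEStronglyMeasurable ψ μ →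
      AEStronglyMeasurable (fun ξ => (ψ ξ : ℂ) * G ξ) μ := fun hψ =>
    (Complex.continuous_ofReal.comp_aestronglyMeasurable hψ).mul hG
  have hbd : ∀ {ψ : E → ℝ} {B : ℝ} (ξ : E), |ψ ξ| ≤ B * (1 + ‖ξ‖ ^ 2) →
      ‖(ψ ξ : ℂ) * G ξ‖ ≤ B * ((1 + ‖ξ‖ ^ 2) * ‖G ξ‖) := fun ξ h => by
    rw [norm_mul, Complex.norm_real, Real.norm_eq_abs, ← mul_assoc]
    gcongr
  have hsub : Icc (t / 2) (2 * t) ⊆ Ioi 0 := fun s hs => lt_of_lt_of_le (half_pos ht) hs.1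
  obtain ⟨B, hB⟩ := isCompact_Icc.bddAbove_image (hb.mono hsub)
  have hnhds : Icc (t / 2) (2 * t) ∈ 𝓝 t := Icc_mem_nhds (by linarith) (by linarith)
  refine (hasDerivAt_integral_of_dominated_loc_of_deriv_le (s := Icc (t / 2) (2 * t))
    (F := fun s ξ => (φ s ξ : ℂ) * G ξ) (F' := fun s ξ => (φ' s ξ : ℂ) * G ξ)
    (bound := fun ξ => B * ((1 + ‖ξ‖ ^ 2) * ‖G ξ‖)) hnhds ?_ ?_ ?_ ?_ ?_ ?_).2
  · filter_upwards [hnhds] with s hs using hmeas (hφ s (hsub hs))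
  · exact (hGi.const_mul (b t)).mono' (hmeas (hφ t ht)) (.of_forall fun ξ => hbd ξ (hφb t ht ξ))
  · exact hmeas (hφ' t ht)
  · refine .of_forall fun ξ s hs => hbd ξ ((hφb' s (hsub hs) ξ).trans ?_)
    gcongr
    exact hB (mem_image_of_mem b hs)
  · exact hGi.const_mul B
  · exact .of_forall fun ξ s hs => ((hd s (hsub hs) ξ).ofReal_comp).mul_const (G ξ)

variable {d : ℕ}

/-- The Fourier multiplier that maps `g` to the solution at time `t`. -/
def neumannMultiplier (σ t : ℝ) (ξ : EuclideanSpace ℝ (Fin d)) : ℝ :=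
  timeFactor σ (Real.pi ^ 2 * ‖ξ‖ ^ 2) t

/-- The time derivative of `neumannMultiplier`. -/
def neumannMultiplierDeriv (σ t : ℝ) (ξ : EuclideanSpace ℝ (Fin d)) : ℝ :=
  timeFactorDeriv σ (Real.pi ^ 2 * ‖ξ‖ ^ 2) t

lemma continuous_neumannMultiplier {σ : ℝ} (hσ : 0 < σ) (t : ℝ) :
    Continuous (neumannMultiplier (d := d) σ t) := by
  unfold neumannMultiplier timeFactor
  exact continuous_const.mul
    ((continuous_besselSeries (by positivity : 0 < σ + 1)).comp (by fun_prop))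

lemma continuous_neumannMultiplierDeriv {σ : ℝ} (hσ : 0 < σ) (t : ℝ) :
    Continuous (neumannMultiplierDeriv (d := d) σ t) := by
  unfold neumannMultiplierDeriv timeFactorDeriv
  exact continuous_const.mul ((continuous_besselSeries hσ).comp (by fun_prop))

lemma abs_neumannMultiplier_le {σ t : ℝ} (hσ : 0 < σ) (ht : 0 ≤ t)
    (ξ : EuclideanSpace ℝ (Fin d)) : |neumannMultiplier σ t ξ| ≤ t ^ (2 * σ) :=
  abs_timeFactor_le hσ (by positivity) ht

/-- The solution of the Neumann problem. -/
def neumannSolution (g : 𝓢(EuclideanSpace ℝ (Fin d), ℂ)) (σ t : ℝ) :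
    EuclideanSpace ℝ (Fin d) → ℂ :=
  𝓕⁻ fun ξ => (neumannMultiplier σ t ξ : ℂ) * (𝓕 g) ξ

lemma integrable_bounded_mul_schwartz {m : EuclideanSpace ℝ (Fin d) → ℝ} (hm : Continuous m)
    {B : ℝ} (hB : ∀ ξ, |m ξ| ≤ B) (φ : 𝓢(EuclideanSpace ℝ (Fin d), ℂ)) :
    Integrable fun ξ => (m ξ : ℂ) * φ ξ :=
  φ.integrable.bdd_mul (c := B) (by fun_prop) (.of_forall fun ξ => by simpa using hB ξ)

lemma memLp_bounded_mul_schwartz {m : EuclideanSpace ℝ (Fin d) → ℝ} (hm : Continuous m)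
    {B : ℝ} (hB : ∀ ξ, |m ξ| ≤ B) (φ : 𝓢(EuclideanSpace ℝ (Fin d), ℂ)) :
    MemLp (fun ξ => (m ξ : ℂ) * φ ξ) 2 volume := by
  refine (φ.memLp 2 volume).of_le_mul (c := B) (by fun_prop) (.of_forall fun ξ => ?_)
  rw [norm_mul, Complex.norm_real]
  gcongr
  exact hB ξ

/-- The Fourier side of the pairing of `g` with `h`. -/
def pairingDensity (g : 𝓢(EuclideanSpace ℝ (Fin d), ℂ)) {h : EuclideanSpace ℝ (Fin d) → ℂ}
    (hh : MemLp h 2 volume) (ξ : EuclideanSpace ℝ (Fin d)) : ℂ :=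
  (𝓕 g) ξ * (starRingEnd ℂ) ((𝓕 (hh.toLp h) : Lp ℂ 2 (volume : Measure _)) ξ)

lemma memLp_conj_fourier {h : EuclideanSpace ℝ (Fin d) → ℂ} (hh : MemLp h 2 volume) :
    MemLp (fun ξ => (starRingEnd ℂ) ((𝓕 (hh.toLp h) : Lp ℂ 2 (volume : Measure _)) ξ))
      2 volume := by
  exact (Lp.memLp (𝓕 (hh.toLp h) : Lp ℂ 2 (volume : Measure _))).star

lemma aestronglyMeasurable_pairingDensity (g : 𝓢(EuclideanSpace ℝ (Fin d), ℂ))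
    {h : EuclideanSpace ℝ (Fin d) → ℂ} (hh : MemLp h 2 volume) :
    AEStronglyMeasurable (pairingDensity g hh) volume :=
  (𝓕 g).continuous.aestronglyMeasurable.mul (memLp_conj_fourier hh).1

/-- By Cauchy–Schwarz: `(1 + ‖ξ‖²) 𝓕 g` is a Schwartz function, hence in `L²`, and the other factor
is in `L²`. This is the majorant for the time derivatives and for the initial limits. -/
lemma integrable_quadratic_mul_pairingDensity (g : 𝓢(EuclideanSpace ℝ (Fin d), ℂ))
    {h : EuclideanSpace ℝ (Fin d) → ℂ} (hh : MemLp h 2 volume) :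
    Integrable fun ξ => (1 + ‖ξ‖ ^ 2) * ‖pairingDensity g hh ξ‖ := by
  have ht : (fun x : EuclideanSpace ℝ (Fin d) => (1 : ℝ) + ‖x‖ ^ 2).HasTemperateGrowth := by
    fun_prop
  have h1 : MemLp (fun ξ : EuclideanSpace ℝ (Fin d) => (1 + ‖ξ‖ ^ 2) • (𝓕 g) ξ) 2 volume := by
    have := (SchwartzMap.smulLeftCLM ℂ
      (fun x : EuclideanSpace ℝ (Fin d) => (1 : ℝ) + ‖x‖ ^ 2) (𝓕 g)).memLp 2 volume
    rwa [SchwartzMap.smulLeftCLM_apply ht] at this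
  refine (h1.integrable_mul (memLp_conj_fourier hh)).norm.congr (.of_forall fun ξ => ?_)
  have : (0 : ℝ) ≤ 1 + ‖ξ‖ ^ 2 := by positivity
  simp only [Pi.mul_apply, norm_mul, norm_smul, Real.norm_of_nonneg this, pairingDensity]
  ring

lemma pairing_neumannSolution (g : 𝓢(EuclideanSpace ℝ (Fin d), ℂ)) {σ t : ℝ} (hσ : 0 < σ)
    (ht : 0 ≤ t) {h : EuclideanSpace ℝ (Fin d) → ℂ} (hh : MemLp h 2 volume) :
    pairing (neumannSolution g σ t) h =
      ∫ ξ, (neumannMultiplier σ t ξ : ℂ) * pairingDensity g hh ξ := by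
  have hB := abs_neumannMultiplier_le (d := d) hσ ht
  have hc := continuous_neumannMultiplier (d := d) hσ t
  rw [neumannSolution, pairing_fourierInv (integrable_bounded_mul_schwartz hc hB _)
    (memLp_bounded_mul_schwartz hc hB _) hh]
  simp only [pairingDensity, mul_assoc]

lemma pairing_eq_integral_pairingDensity (g : 𝓢(EuclideanSpace ℝ (Fin d), ℂ))
    {h : EuclideanSpace ℝ (Fin d) → ℂ} (hh : MemLp h 2 volume) :
    pairing g h = ∫ ξ, pairingDensity g hh ξ := by
  have h1 := pairing_fourierInv (𝓕 g).integrable ((𝓕 g).memLp 2 volume) hh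
  rw [← SchwartzMap.fourierInv_coe, FourierTransform.fourierInv_fourier_eq] at h1
  exact h1

/-- A common bound for the multiplier and its first two derivatives in time. -/
def multiplierBound (σ t : ℝ) : ℝ :=
  t ^ (2 * σ) * (1 + 4 * Real.pi ^ 2) +
    2 * σ * t ^ (2 * σ - 1) * (1 + Real.pi ^ 2 * t ^ 2 / σ) * (1 + |1 - 2 * σ| / t)

lemma continuousOn_multiplierBound (σ : ℝ) : ContinuousOn (multiplierBound σ) (Ioi 0) := by
  intro t ht
  have ht' : t ≠ 0 := (mem_Ioi.1 ht).ne'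
  unfold multiplierBound
  refine ContinuousAt.continuousWithinAt ?_
  have h1 := Real.continuousAt_rpow_const t (2 * σ) (Or.inl ht')
  have h2 := Real.continuousAt_rpow_const t (2 * σ - 1) (Or.inl ht')
  have h3 : ContinuousAt (fun t : ℝ => |1 - 2 * σ| / t) t :=
    continuousAt_const.div continuousAt_id ht'
  fun_prop

lemma abs_neumannMultiplier_le_bound {σ t : ℝ} (hσ : 0 < σ) (ht : 0 < t)
    (ξ : EuclideanSpace ℝ (Fin d)) :
    |neumannMultiplier σ t ξ| ≤ multiplierBound σ t * (1 + ‖ξ‖ ^ 2) := by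
  refine (abs_neumannMultiplier_le hσ ht.le ξ).trans ?_
  have h1 : t ^ (2 * σ) ≤ multiplierBound σ t := by
    unfold multiplierBound
    have : t ^ (2 * σ) ≤ t ^ (2 * σ) * (1 + 4 * Real.pi ^ 2) :=
      le_mul_of_one_le_right (by positivity) (by nlinarith [Real.pi_pos])
    have : 0 ≤ 2 * σ * t ^ (2 * σ - 1) * (1 + Real.pi ^ 2 * t ^ 2 / σ) * (1 + |1 - 2 * σ| / t) := by
      positivity
    linarith
  have h0 : 0 ≤ multiplierBound σ t := (by positivity : 0 ≤ t ^ (2 * σ)).trans h1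
  nlinarith [mul_nonneg h0 (sq_nonneg ‖ξ‖)]

lemma abs_neumannMultiplierDeriv_le {σ t : ℝ} (hσ : 0 < σ) (ht : 0 < t)
    (ξ : EuclideanSpace ℝ (Fin d)) : |neumannMultiplierDeriv σ t ξ| ≤
      2 * σ * t ^ (2 * σ - 1) * (1 + Real.pi ^ 2 * t ^ 2 / σ) * (1 + ‖ξ‖ ^ 2) := by
  refine (abs_timeFactorDeriv_le hσ (by positivity) ht.le).trans ?_
  rw [mul_assoc _ _ (1 + ‖ξ‖ ^ 2)]
  gcongr
  have h : 0 ≤ Real.pi ^ 2 * t ^ 2 / σ := by positivity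
  have e : Real.pi ^ 2 * ‖ξ‖ ^ 2 * t ^ 2 / σ = Real.pi ^ 2 * t ^ 2 / σ * ‖ξ‖ ^ 2 := by ring
  rw [e]
  nlinarith [sq_nonneg ‖ξ‖]

lemma abs_neumannMultiplierDeriv_le_bound {σ t : ℝ} (hσ : 0 < σ) (ht : 0 < t)
    (ξ : EuclideanSpace ℝ (Fin d)) :
    |neumannMultiplierDeriv σ t ξ| ≤ multiplierBound σ t * (1 + ‖ξ‖ ^ 2) := by
  refine (abs_neumannMultiplierDeriv_le hσ ht ξ).trans ?_
  gcongr
  unfold multiplierBound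
  have h1 : 0 ≤ t ^ (2 * σ) * (1 + 4 * Real.pi ^ 2) := by positivity
  have h2 : 2 * σ * t ^ (2 * σ - 1) * (1 + Real.pi ^ 2 * t ^ 2 / σ) ≤
      2 * σ * t ^ (2 * σ - 1) * (1 + Real.pi ^ 2 * t ^ 2 / σ) * (1 + |1 - 2 * σ| / t) :=
    le_mul_of_one_le_right (by positivity) (by
      have : 0 ≤ |1 - 2 * σ| / t := by positivity
      linarith)
  linarith

lemma abs_neumannMultiplier_second_le_bound {σ t : ℝ} (hσ : 0 < σ) (ht : 0 < t)
    (ξ : EuclideanSpace ℝ (Fin d)) :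
    |-(1 - 2 * σ) / t * neumannMultiplierDeriv σ t ξ -
      4 * (Real.pi ^ 2 * ‖ξ‖ ^ 2) * neumannMultiplier σ t ξ| ≤
      multiplierBound σ t * (1 + ‖ξ‖ ^ 2) := by
  refine (abs_sub _ _).trans ?_
  rw [abs_mul, abs_mul, abs_div, abs_neg, abs_of_pos ht,
    abs_of_nonneg (by positivity : 0 ≤ 4 * (Real.pi ^ 2 * ‖ξ‖ ^ 2))]
  have h1 := abs_neumannMultiplier_le hσ ht.le ξ
  have h2 := abs_neumannMultiplierDeriv_le hσ ht ξ
  set D := 2 * σ * t ^ (2 * σ - 1) * (1 + Real.pi ^ 2 * t ^ 2 / σ) with hD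
  have hD0 : 0 ≤ D := by positivity
  have hq : 0 ≤ |1 - 2 * σ| / t := by positivity
  have hm : 0 ≤ t ^ (2 * σ) := by positivity
  calc |1 - 2 * σ| / t * |neumannMultiplierDeriv σ t ξ| +
        4 * (Real.pi ^ 2 * ‖ξ‖ ^ 2) * |neumannMultiplier σ t ξ|
      ≤ |1 - 2 * σ| / t * (D * (1 + ‖ξ‖ ^ 2)) +
        4 * (Real.pi ^ 2 * ‖ξ‖ ^ 2) * t ^ (2 * σ) := by gcongr
    -- Nonnegative terms are added so that the sum is exactly `multiplierBound σ t` times `1 +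
    -- ‖ξ‖²`.
    _ ≤ |1 - 2 * σ| / t * (D * (1 + ‖ξ‖ ^ 2)) + D * (1 + ‖ξ‖ ^ 2) +
        (4 * (Real.pi ^ 2 * (1 + ‖ξ‖ ^ 2)) * t ^ (2 * σ) + t ^ (2 * σ) * (1 + ‖ξ‖ ^ 2)) := by
      have a1 : 0 ≤ D * (1 + ‖ξ‖ ^ 2) := by positivity
      have a2 : 0 ≤ t ^ (2 * σ) * (1 + ‖ξ‖ ^ 2) := by positivity
      have a3 : 4 * (Real.pi ^ 2 * ‖ξ‖ ^ 2) * t ^ (2 * σ) ≤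
          4 * (Real.pi ^ 2 * (1 + ‖ξ‖ ^ 2)) * t ^ (2 * σ) := by
        gcongr
        linarith
      linarith
    _ = multiplierBound σ t * (1 + ‖ξ‖ ^ 2) := by
      rw [multiplierBound, ← hD]
      ring

variable {σ : ℝ} (g : 𝓢(EuclideanSpace ℝ (Fin d), ℂ))
  {h : EuclideanSpace ℝ (Fin d) → ℂ}

lemma hasDerivAt_pairing_neumannSolution (hσ : 0 < σ) (hh : MemLp h 2 volume) {t : ℝ}
    (ht : 0 < t) : HasDerivAt (fun s => pairing (neumannSolution g σ s) h)
      (∫ ξ, (neumannMultiplierDeriv σ t ξ : ℂ) * pairingDensity g hh ξ) t := by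
  have key := hasDerivAt_integral_mul_of_quadratic_bound
    (φ := neumannMultiplier σ) (φ' := neumannMultiplierDeriv σ)
    (continuousOn_multiplierBound σ)
    (fun t _ => (continuous_neumannMultiplier hσ t).aestronglyMeasurable)
    (fun t _ => (continuous_neumannMultiplierDeriv hσ t).aestronglyMeasurable)
    (fun t ht ξ => abs_neumannMultiplier_le_bound hσ ht ξ)
    (fun t ht ξ => abs_neumannMultiplierDeriv_le_bound hσ ht ξ)
    (fun t ht ξ => hasDerivAt_timeFactor hσ ht)
    (aestronglyMeasurable_pairingDensity g hh) (integrable_quadratic_mul_pairingDensity g hh) ht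
  refine key.congr_of_eventuallyEq ?_
  filter_upwards [Ioi_mem_nhds ht] with s hs
  exact pairing_neumannSolution g hσ (mem_Ioi.1 hs).le hh

lemma hasDerivAt_deriv_pairing_neumannSolution (hσ : 0 < σ) (hh : MemLp h 2 volume) {t : ℝ}
    (ht : 0 < t) : HasDerivAt (deriv fun s => pairing (neumannSolution g σ s) h)
      (∫ ξ, ((-(1 - 2 * σ) / t * neumannMultiplierDeriv σ t ξ -
        4 * (Real.pi ^ 2 * ‖ξ‖ ^ 2) * neumannMultiplier σ t ξ : ℝ) : ℂ) *
          pairingDensity g hh ξ) t := by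
  have key := hasDerivAt_integral_mul_of_quadratic_bound
    (φ := neumannMultiplierDeriv (d := d) σ)
    (φ' := fun t ξ => -(1 - 2 * σ) / t * neumannMultiplierDeriv σ t ξ -
        4 * (Real.pi ^ 2 * ‖ξ‖ ^ 2) * neumannMultiplier σ t ξ)
    (continuousOn_multiplierBound σ)
    (fun t _ => (continuous_neumannMultiplierDeriv hσ t).aestronglyMeasurable)
    (fun t _ => by
      have h1 := continuous_neumannMultiplierDeriv (d := d) hσ t
      have h2 := continuous_neumannMultiplier (d := d) hσ t
      exact Continuous.aestronglyMeasurable (by fun_prop))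
    (fun t ht ξ => abs_neumannMultiplierDeriv_le_bound hσ ht ξ)
    (fun t ht ξ => abs_neumannMultiplier_second_le_bound hσ ht ξ)
    (fun t ht ξ => hasDerivAt_timeFactorDeriv hσ ht)
    (aestronglyMeasurable_pairingDensity g hh) (integrable_quadratic_mul_pairingDensity g hh) ht
  refine key.congr_of_eventuallyEq ?_
  filter_upwards [Ioi_mem_nhds ht] with s hs
  exact (hasDerivAt_pairing_neumannSolution g hσ hh hs).deriv

lemma isNeumannSolution_neumannSolution (hσ : 0 < σ) :
    IsNeumannSolution σ g (neumannSolution g σ) where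
  continuous t ht := continuous_fourierInv_of_integrable
    (integrable_bounded_mul_schwartz (continuous_neumannMultiplier hσ t)
      (abs_neumannMultiplier_le hσ (le_of_lt ht)) _)
  memLp t ht := memLp_fourierInv
    (integrable_bounded_mul_schwartz (continuous_neumannMultiplier hσ t)
      (abs_neumannMultiplier_le hσ (le_of_lt ht)) _)
    (memLp_bounded_mul_schwartz (continuous_neumannMultiplier hσ t)
      (abs_neumannMultiplier_le hσ (le_of_lt ht)) _)
  differentiableAt h hh t ht :=
    ⟨(hasDerivAt_pairing_neumannSolution g hσ hh ht).differentiableAt,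
      (hasDerivAt_deriv_pairing_neumannSolution g hσ hh ht).differentiableAt⟩
  equation t ht := by
    have hB := abs_neumannMultiplier_le (d := d) hσ (le_of_lt ht)
    have hc := continuous_neumannMultiplier (d := d) hσ t
    -- The unbounded symbol is absorbed by the data: `laplaceSymbol` times `𝓕 g` is `𝓕 (Δ g)`, again
    -- a Schwartz function.
    have e : (fun ξ => laplaceSymbol ξ * ((neumannMultiplier σ t ξ : ℂ) * (𝓕 g) ξ)) =
        fun ξ => (neumannMultiplier σ t ξ : ℂ) * (𝓕 (Δ g)) ξ := by
      funext ξ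
      rw [fourier_laplacian_apply]
      ring
    refine ⟨_, isL2Laplacian_fourierInv (integrable_bounded_mul_schwartz hc hB _)
      (memLp_bounded_mul_schwartz hc hB _) (e ▸ integrable_bounded_mul_schwartz hc hB _)
      (e ▸ memLp_bounded_mul_schwartz hc hB _), fun h hh => ?_⟩
    rw [pairing_fourierInv (e ▸ integrable_bounded_mul_schwartz hc hB _)
      (e ▸ memLp_bounded_mul_schwartz hc hB _) hh,
      (hasDerivAt_deriv_pairing_neumannSolution g hσ hh ht).deriv,
      (hasDerivAt_pairing_neumannSolution g hσ hh ht).deriv, ← integral_const_mul,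
      ← integral_add]
    · refine integral_congr_ae (.of_forall fun ξ => ?_)
      simp only [laplaceSymbol, pairingDensity]
      push_cast
      ring
    · refine ((integrable_quadratic_mul_pairingDensity g hh).const_mul (multiplierBound σ t)).mono'
        ?_ (.of_forall fun ξ => ?_)
      · have h1 := continuous_neumannMultiplierDeriv (d := d) hσ t
        exact (Continuous.aestronglyMeasurable (by fun_prop)).mul
          (aestronglyMeasurable_pairingDensity g hh)
      · rw [norm_mul, Complex.norm_real, Real.norm_eq_abs, ← mul_assoc (multiplierBound σ t)]
        exact mul_le_mul_of_nonneg_right (abs_neumannMultiplier_second_le_bound hσ ht ξ)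
          (norm_nonneg _)
    · refine (((integrable_quadratic_mul_pairingDensity g hh).const_mul
        (multiplierBound σ t)).mono' ?_ (.of_forall fun ξ => ?_)).const_mul _
      · have h1 := continuous_neumannMultiplierDeriv (d := d) hσ t
        exact (Continuous.aestronglyMeasurable (by fun_prop)).mul
          (aestronglyMeasurable_pairingDensity g hh)
      · rw [norm_mul, Complex.norm_real, Real.norm_eq_abs, ← mul_assoc]
        gcongr
        exact abs_neumannMultiplierDeriv_le_bound hσ ht ξ
  initial_value h hh := by
    have h0 : Tendsto (fun t : ℝ => t ^ (2 * σ)) (𝓝[>] 0) (𝓝 0) := by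
      have := Real.continuousAt_rpow_const 0 (2 * σ) (Or.inr (by positivity))
      have h1 := this.tendsto
      rw [Real.zero_rpow (by positivity)] at h1
      exact h1.mono_left nhdsWithin_le_nhds
    have hlim : Tendsto (fun t => ∫ ξ, (neumannMultiplier σ t ξ : ℂ) * pairingDensity g hh ξ)
        (𝓝[>] 0) (𝓝 (∫ ξ : EuclideanSpace ℝ (Fin d), (0 : ℂ))) := by
      refine tendsto_integral_filter_of_dominated_convergence _ ?_ ?_
        (integrable_quadratic_mul_pairingDensity g hh) ?_
      · refine .of_forall fun t => ?_
        have h1 := continuous_neumannMultiplier (d := d) hσ t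
        exact (Continuous.aestronglyMeasurable (by fun_prop)).mul
          (aestronglyMeasurable_pairingDensity g hh)
      · filter_upwards [Ioo_mem_nhdsGT one_pos] with t ht
        refine .of_forall fun ξ => ?_
        rw [norm_mul, Complex.norm_real, Real.norm_eq_abs]
        gcongr
        have h1 := abs_neumannMultiplier_le hσ ht.1.le ξ
        have h2 := Real.rpow_le_one ht.1.le ht.2.le (by positivity : 0 ≤ 2 * σ)
        nlinarith [sq_nonneg ‖ξ‖]
      · refine .of_forall fun ξ => ?_
        have h1 : Tendsto (fun t => neumannMultiplier σ t ξ) (𝓝[>] 0) (𝓝 0) := by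
          refine squeeze_zero_norm' ?_ h0
          filter_upwards [self_mem_nhdsWithin] with t ht
          exact abs_neumannMultiplier_le hσ (le_of_lt ht) ξ
        simpa using ((Complex.continuous_ofReal.tendsto 0).comp h1).mul_const
          (pairingDensity g hh ξ)
    rw [integral_zero] at hlim
    refine hlim.congr' ?_
    filter_upwards [self_mem_nhdsWithin] with t ht
    exact (pairing_neumannSolution g hσ (le_of_lt ht) hh).symm
  initial_derivative h hh := by
    -- The powers of `t` in `∂_t^σ` cancel those in the multiplier's derivative, leaving `K_σ`,
    -- which tends to `1`. For `σ < 1/2` only the linear bound on `K_σ` is available, and the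
    -- quadratic weight absorbs it.
    have hlim : Tendsto (fun t => ∫ ξ,
        (besselSeries σ (Real.pi ^ 2 * ‖ξ‖ ^ 2 * t ^ 2) : ℂ) * pairingDensity g hh ξ)
        (𝓝[>] 0) (𝓝 (∫ ξ, pairingDensity g hh ξ)) := by
      refine tendsto_integral_filter_of_dominated_convergence _ ?_ ?_
        ((integrable_quadratic_mul_pairingDensity g hh).const_mul (1 + Real.pi ^ 2 / σ)) ?_
      · refine .of_forall fun t => ?_
        have h1 : Continuous fun ξ : EuclideanSpace ℝ (Fin d) =>
            besselSeries σ (Real.pi ^ 2 * ‖ξ‖ ^ 2 * t ^ 2) :=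
          (continuous_besselSeries hσ).comp (by fun_prop)
        exact (Continuous.aestronglyMeasurable (by fun_prop)).mul
          (aestronglyMeasurable_pairingDensity g hh)
      · filter_upwards [Ioo_mem_nhdsGT one_pos] with t ht
        refine .of_forall fun ξ => ?_
        rw [norm_mul, Complex.norm_real, Real.norm_eq_abs, ← mul_assoc]
        gcongr
        refine (abs_besselSeries_le hσ (by positivity)).trans ?_
        have h2 : t ^ 2 ≤ 1 := pow_le_one₀ ht.1.le ht.2.le
        have h3 : Real.pi ^ 2 * ‖ξ‖ ^ 2 * t ^ 2 / σ ≤ Real.pi ^ 2 * ‖ξ‖ ^ 2 * 1 / σ := by gcongr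
        have h4 : 0 ≤ Real.pi ^ 2 / σ := by positivity
        have e : Real.pi ^ 2 * ‖ξ‖ ^ 2 * 1 / σ = Real.pi ^ 2 / σ * ‖ξ‖ ^ 2 := by ring
        rw [e] at h3
        nlinarith [sq_nonneg ‖ξ‖]
      · refine .of_forall fun ξ => ?_
        have h1 : Continuous fun t : ℝ => besselSeries σ (Real.pi ^ 2 * ‖ξ‖ ^ 2 * t ^ 2) :=
          (continuous_besselSeries hσ).comp (by fun_prop)
        have h2 := (h1.tendsto 0).mono_left (nhdsWithin_le_nhds (s := Ioi 0))
        simp only [ne_eq, OfNat.ofNat_ne_zero, not_false_eq_true, zero_pow, mul_zero,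
          besselSeries_zero] at h2
        simpa using ((Complex.continuous_ofReal.tendsto 1).comp h2).mul_const
          (pairingDensity g hh ξ)
    rw [pairing_eq_integral_pairingDensity g hh]
    refine hlim.congr' ?_
    filter_upwards [self_mem_nhdsWithin] with t ht
    have ht' : (0 : ℝ) < t := ht
    rw [sigmaDeriv, (hasDerivAt_pairing_neumannSolution g hσ hh ht').deriv, ← integral_const_mul]
    refine integral_congr_ae (.of_forall fun ξ => ?_)
    have e : 1 / (2 * σ) * t ^ (1 - 2 * σ) * neumannMultiplierDeriv σ t ξ =
        besselSeries σ (Real.pi ^ 2 * ‖ξ‖ ^ 2 * t ^ 2) := by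
      have e1 : t ^ (1 - 2 * σ) * t ^ (2 * σ - 1) = 1 := by
        rw [← Real.rpow_add ht']
        simp
      rw [neumannMultiplierDeriv, timeFactorDeriv]
      linear_combination (norm := (field_simp; ring))
        besselSeries σ (Real.pi ^ 2 * ‖ξ‖ ^ 2 * t ^ 2) * e1
    simp only [← mul_assoc]
    rw [← Complex.ofReal_mul, e]

end Existence

/-! ### Uniqueness: iteration of the singular equation on band-limited test functions. -/

section Uniqueness

open scoped FourierTransform InnerProductSpace

/-- A mean value inequality on `[ε, t]` followed by `ε → 0`; nothing is assumed at the singular time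
`0` beyond the two limits. -/
lemma norm_le_of_norm_deriv_le_of_tendsto_zero {f f' : ℝ → ℂ} {B B' : ℝ → ℝ} {T : ℝ}
    (hf : ∀ t > 0, HasDerivAt f (f' t) t) (hB : ∀ t > 0, HasDerivAt B (B' t) t)
    (h : ∀ t ∈ Ioc 0 T, ‖f' t‖ ≤ B' t) (hf0 : Tendsto f (𝓝[>] 0) (𝓝 0))
    (hB0 : Tendsto B (𝓝[>] 0) (𝓝 0)) {t : ℝ} (ht : t ∈ Ioc 0 T) : ‖f t‖ ≤ B t := by
  have key : ∀ ε ∈ Ioo 0 t, ‖f t - f ε‖ ≤ B t - B ε := by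
    intro ε hε
    refine image_norm_le_of_norm_deriv_right_le_deriv_boundary' (f := fun s => f s - f ε)
      (f' := f') (a := ε) (b := t) (B := fun s => B s - B ε) (B' := B') ?_ ?_ (by simp) ?_ ?_ ?_
      (right_mem_Icc.2 hε.2.le)
    · exact fun s hs => ((hf s (hε.1.trans_le hs.1)).sub_const _).continuousAt.continuousWithinAt
    · exact fun s hs => ((hf s (hε.1.trans_le hs.1)).sub_const _).hasDerivWithinAt
    · exact fun s hs => ((hB s (hε.1.trans_le hs.1)).sub_const _).continuousAt.continuousWithinAt
    · exact fun s hs => ((hB s (hε.1.trans_le hs.1)).sub_const _).hasDerivWithinAt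
    · exact fun s hs => h s ⟨hε.1.trans_le hs.1, hs.2.le.trans ht.2⟩
  have h1 : Tendsto (fun ε => ‖f t - f ε‖) (𝓝[>] 0) (𝓝 ‖f t‖) := by
    simpa using (tendsto_const_nhds.sub hf0).norm
  have h2 : Tendsto (fun ε => B t - B ε) (𝓝[>] 0) (𝓝 (B t)) := by
    simpa using tendsto_const_nhds.sub hB0
  exact le_of_tendsto_of_tendsto h1 h2 (eventually_of_mem (Ioo_mem_nhdsGT ht.1) key)

lemma tendsto_const_mul_rpow_nhdsGT_zero {a : ℝ} (ha : 0 < a) (K : ℝ) :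
    Tendsto (fun t : ℝ => K * t ^ a) (𝓝[>] 0) (𝓝 0) := by
  have h := (Real.continuousAt_rpow_const 0 a (Or.inr ha.le)).tendsto
  rw [Real.zero_rpow ha.ne'] at h
  simpa using (h.mono_left nhdsWithin_le_nhds).const_mul K

lemma hasDerivAt_const_mul_rpow {a t : ℝ} (ha : a ≠ 0) (ht : 0 < t) (K : ℝ) :
    HasDerivAt (fun t : ℝ => K / a * t ^ a) (K * t ^ (a - 1)) t := by
  refine ((Real.hasDerivAt_rpow_const (Or.inl ht.ne')).const_mul (K / a)).congr_deriv ?_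
  field_simp

/-- One step of the iteration for the singular equation with zero initial data. -/
lemma norm_le_of_norm_equation_le {σ T K : ℝ} (hσ1 : σ < 1) (hK : 0 ≤ K) {F : ℝ → ℂ}
    (hF : ∀ t > 0, DifferentiableAt ℝ F t) (hF' : ∀ t > 0, DifferentiableAt ℝ (deriv F) t)
    (h0 : Tendsto F (𝓝[>] 0) (𝓝 0))
    (h0' : Tendsto (fun t => ((t ^ (1 - 2 * σ) : ℝ) : ℂ) * deriv F t) (𝓝[>] 0) (𝓝 0)) (j : ℕ)
    (h : ∀ t ∈ Ioc 0 T,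
      ‖deriv (deriv F) t + (((1 - 2 * σ) / t : ℝ) : ℂ) * deriv F t‖ ≤ K * t ^ (2 * j))
    {t : ℝ} (ht : t ∈ Ioc 0 T) :
    ‖F t‖ ≤ K / (4 * (1 - σ) * (j + 1)) * t ^ (2 * (j + 1)) := by
  have hj : (0 : ℝ) ≤ j := j.cast_nonneg
  -- The integrating factor is `t^{1-2σ}`: the derivative of `t^{1-2σ} F'` is `t^{1-2σ}` times the
  -- left-hand side of the equation. Integrating `t^{1-2σ+2j}` gives the exponent `a`, which is
  -- positive because `σ < 1`; removing the factor and integrating again gives `b = 2j + 2`.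
  set a : ℝ := 2 - 2 * σ + 2 * j with ha
  have ha0 : 0 < a := by linarith
  have hG : ∀ t ∈ Ioc 0 T, ‖((t ^ (1 - 2 * σ) : ℝ) : ℂ) * deriv F t‖ ≤ K / a * t ^ a := by
    intro t ht
    refine norm_le_of_norm_deriv_le_of_tendsto_zero
      (f := fun t => ((t ^ (1 - 2 * σ) : ℝ) : ℂ) * deriv F t)
      (f' := fun t => ((t ^ (1 - 2 * σ) : ℝ) : ℂ) *
        (deriv (deriv F) t + (((1 - 2 * σ) / t : ℝ) : ℂ) * deriv F t))
      (B := fun t => K / a * t ^ a) (B' := fun t => K * t ^ (a - 1)) ?_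
      (fun t ht => hasDerivAt_const_mul_rpow ha0.ne' ht K) ?_ h0'
      (tendsto_const_mul_rpow_nhdsGT_zero ha0 _) ht
    · intro t ht
      have h1 := (Real.hasDerivAt_rpow_const (p := 1 - 2 * σ) (Or.inl (ne_of_gt ht))).ofReal_comp
      refine (h1.mul (hF' t ht).hasDerivAt).congr_deriv ?_
      rw [Real.rpow_sub_one (ne_of_gt ht)]
      push_cast
      ring
    · intro t ht
      rw [norm_mul, Complex.norm_real, Real.norm_of_nonneg (Real.rpow_nonneg ht.1.le _)]
      have e : t ^ (a - 1) = t ^ (1 - 2 * σ) * t ^ (2 * j) := by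
        rw [← Real.rpow_natCast, ← Real.rpow_add ht.1, ha]
        push_cast
        congr 1
        ring
      have := mul_le_mul_of_nonneg_left (h t ht) (Real.rpow_nonneg ht.1.le (1 - 2 * σ))
      rw [e]
      linarith
  set b : ℝ := 2 + 2 * j with hb
  have hb0 : 0 < b := by positivity
  have hFb : ‖F t‖ ≤ K / a / b * t ^ b := by
    refine norm_le_of_norm_deriv_le_of_tendsto_zero (f' := deriv F)
      (B := fun t => K / a / b * t ^ b) (B' := fun t => K / a * t ^ (b - 1))
      (fun t ht => (hF t ht).hasDerivAt)
      (fun t ht => hasDerivAt_const_mul_rpow hb0.ne' ht _) ?_ h0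
      (tendsto_const_mul_rpow_nhdsGT_zero hb0 _) ht
    intro t ht
    have h1 := hG t ht
    have hp : 0 < t ^ (1 - 2 * σ) := Real.rpow_pos_of_pos ht.1 _
    rw [norm_mul, Complex.norm_real, Real.norm_of_nonneg hp.le] at h1
    have e : t ^ a = t ^ (1 - 2 * σ) * t ^ (b - 1) := by
      rw [← Real.rpow_add ht.1, ha, hb]
      congr 1
      ring
    rw [e] at h1
    refine le_of_mul_le_mul_left ?_ hp
    linarith
  refine hFb.trans ?_
  have e : t ^ b = t ^ (2 * (j + 1)) := by
    rw [← Real.rpow_natCast, hb]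
    push_cast
    congr 1
    ring
  rw [e, div_div]
  have hden : 4 * (1 - σ) * (j + 1) ≤ a * b := by
    rw [ha, hb]
    nlinarith
  have hs : 0 < 1 - σ := by linarith
  have := ht.1
  gcongr

/-- Solutions of a hierarchy of singular equations with zero initial data and geometrically
bounded size vanish. -/
lemma eq_zero_of_hierarchy {σ T C D : ℝ} (hσ1 : σ < 1) (hC : 0 ≤ C) (hD : 0 ≤ D)
    {F : ℕ → ℝ → ℂ} (hF : ∀ n, ∀ t > 0, DifferentiableAt ℝ (F n) t)
    (hF' : ∀ n, ∀ t > 0, DifferentiableAt ℝ (deriv (F n)) t)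
    (h0 : ∀ n, Tendsto (F n) (𝓝[>] 0) (𝓝 0))
    (h0' : ∀ n, Tendsto (fun t => ((t ^ (1 - 2 * σ) : ℝ) : ℂ) * deriv (F n) t) (𝓝[>] 0) (𝓝 0))
    (heq : ∀ n, ∀ t > 0,
      deriv (deriv (F n)) t + (((1 - 2 * σ) / t : ℝ) : ℂ) * deriv (F n) t = F (n + 1) t)
    (hb : ∀ n, ∀ t ∈ Ioc 0 T, ‖F n t‖ ≤ D * C ^ n) {t : ℝ} (ht : t ∈ Ioc 0 T) : F 0 t = 0 := by
  have hδ : 0 < 4 * (1 - σ) := by linarith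
  -- Applying the step `m` times to the hierarchy produces `m!` in the denominator; letting `m → ∞`
  -- with `n = 0` then forces `F 0 t = 0`.
  have key : ∀ m n : ℕ, ∀ t ∈ Ioc 0 T,
      ‖F n t‖ ≤ D * C ^ (n + m) / ((4 * (1 - σ)) ^ m * m.factorial) * t ^ (2 * m) := by
    intro m
    induction m with
    | zero => simpa using hb
    | succ m ih =>
      intro n t ht
      have h1 := norm_le_of_norm_equation_le (K := D * C ^ (n + 1 + m) /
        ((4 * (1 - σ)) ^ m * m.factorial)) hσ1 (by positivity) (hF n) (hF' n) (h0 n) (h0' n) m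
        (fun s hs => by rw [heq n s hs.1]; exact ih (n + 1) s hs) ht
      refine h1.trans_eq ?_
      rw [div_div, Nat.factorial_succ]
      push_cast
      ring_nf
  have hlim : Tendsto (fun m : ℕ => D * ((C * t ^ 2 / (4 * (1 - σ))) ^ m / m.factorial)) atTop
      (𝓝 (D * 0)) := (FloorSemiring.tendsto_pow_div_factorial_atTop _).const_mul D
  rw [mul_zero] at hlim
  have hle : ‖F 0 t‖ ≤ 0 := by
    refine ge_of_tendsto' hlim fun m => (key m 0 t ht).trans_eq ?_
    rw [div_pow, mul_pow, pow_mul, zero_add]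
    field_simp
    ring
  exact norm_le_zero_iff.1 hle

variable {d : ℕ}

lemma integrable_mul_conj {f h : EuclideanSpace ℝ (Fin d) → ℂ} (hf : MemLp f 2 volume)
    (hh : MemLp h 2 volume) : Integrable fun x => f x * (starRingEnd ℂ) (h x) :=
  hf.integrable_mul hh.star

lemma pairing_sub {f₁ f₂ h : EuclideanSpace ℝ (Fin d) → ℂ} (hf₁ : MemLp f₁ 2 volume)
    (hf₂ : MemLp f₂ 2 volume) (hh : MemLp h 2 volume) :
    pairing (fun x => f₁ x - f₂ x) h = pairing f₁ h - pairing f₂ h := by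
  simp only [pairing, sub_mul]
  exact integral_sub (integrable_mul_conj hf₁ hh) (integrable_mul_conj hf₂ hh)

lemma IsL2Laplacian.sub {f₁ f₂ w₁ w₂ : EuclideanSpace ℝ (Fin d) → ℂ}
    (h₁ : IsL2Laplacian f₁ w₁) (h₂ : IsL2Laplacian f₂ w₂) :
    IsL2Laplacian (fun x => f₁ x - f₂ x) (fun x => w₁ x - w₂ x) := by
  refine ⟨h₁.1.sub h₂.1, h₁.2.1.sub h₂.2.1, fun φ => ?_⟩
  have hi : ∀ {f : EuclideanSpace ℝ (Fin d) → ℂ} (_ : MemLp f 2 volume)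
      (ψ : 𝓢(EuclideanSpace ℝ (Fin d), ℂ)), Integrable fun x => f x * ψ x :=
    fun hf ψ => hf.integrable_mul (ψ.memLp 2 volume)
  simp only [sub_mul]
  rw [integral_sub (hi h₁.1 _) (hi h₂.1 _), integral_sub (hi h₁.2.1 _) (hi h₂.2.1 _),
    h₁.2.2, h₂.2.2]

lemma IsNeumannSolution.sub {σ : ℝ} {g : EuclideanSpace ℝ (Fin d) → ℂ}
    {v₁ v₂ : ℝ → EuclideanSpace ℝ (Fin d) → ℂ} (h₁ : IsNeumannSolution σ g v₁)
    (h₂ : IsNeumannSolution σ g v₂) :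
    IsNeumannSolution σ (fun _ => 0) (fun t x => v₁ t x - v₂ t x) := by
  have hp : ∀ {h : EuclideanSpace ℝ (Fin d) → ℂ}, MemLp h 2 volume → ∀ t > 0,
      pairing (fun x => v₁ t x - v₂ t x) h = pairing (v₁ t) h - pairing (v₂ t) h :=
    fun hh t ht => pairing_sub (h₁.memLp t ht) (h₂.memLp t ht) hh
  have hd : ∀ {h : EuclideanSpace ℝ (Fin d) → ℂ}, MemLp h 2 volume → ∀ t > 0,
      HasDerivAt (fun s => pairing (fun x => v₁ s x - v₂ s x) h)
        (deriv (fun s => pairing (v₁ s) h) t - deriv (fun s => pairing (v₂ s) h) t) t := by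
    intro h hh t ht
    refine ((h₁.differentiableAt h hh t ht).1.hasDerivAt.sub
      (h₂.differentiableAt h hh t ht).1.hasDerivAt).congr_of_eventuallyEq ?_
    filter_upwards [Ioi_mem_nhds ht] with s hs using hp hh s hs
  have hd2 : ∀ {h : EuclideanSpace ℝ (Fin d) → ℂ}, MemLp h 2 volume → ∀ t > 0,
      HasDerivAt (deriv fun s => pairing (fun x => v₁ s x - v₂ s x) h)
        (deriv (deriv fun s => pairing (v₁ s) h) t - deriv (deriv fun s => pairing (v₂ s) h) t)
        t := by
    intro h hh t ht
    refine ((h₁.differentiableAt h hh t ht).2.hasDerivAt.sub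
      (h₂.differentiableAt h hh t ht).2.hasDerivAt).congr_of_eventuallyEq ?_
    filter_upwards [Ioi_mem_nhds ht] with s hs using (hd hh s hs).deriv
  refine ⟨fun t ht => (h₁.continuous t ht).sub (h₂.continuous t ht),
    fun t ht => (h₁.memLp t ht).sub (h₂.memLp t ht),
    fun h hh t ht => ⟨(hd hh t ht).differentiableAt, (hd2 hh t ht).differentiableAt⟩,
    fun t ht => ?_, fun h hh => ?_, fun h hh => ?_⟩
  · obtain ⟨w₁, hw₁, e₁⟩ := h₁.equation t ht
    obtain ⟨w₂, hw₂, e₂⟩ := h₂.equation t ht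
    refine ⟨_, hw₁.sub hw₂, fun h hh => ?_⟩
    rw [(hd hh t ht).deriv, (hd2 hh t ht).deriv, pairing_sub hw₁.2.1 hw₂.2.1 hh, ← e₁ h hh,
      ← e₂ h hh]
    ring
  · have := (h₁.initial_value h hh).sub (h₂.initial_value h hh)
    rw [sub_zero] at this
    refine this.congr' ?_
    filter_upwards [self_mem_nhdsWithin] with t ht using (hp hh t ht).symm
  · have := (h₁.initial_derivative h hh).sub (h₂.initial_derivative h hh)
    rw [sub_self] at this
    rw [show pairing (fun _ => 0) h = 0 by simp [pairing]]
    refine this.congr' ?_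
    filter_upwards [self_mem_nhdsWithin] with t ht
    rw [sigmaDeriv, sigmaDeriv, sigmaDeriv, (hd hh t ht).deriv]
    ring

/-- Weak continuity and the initial value bound the `L²` norm locally uniformly in time. -/
lemma IsNeumannSolution.exists_norm_pairing_le {σ : ℝ} {g : EuclideanSpace ℝ (Fin d) → ℂ}
    {v : ℝ → EuclideanSpace ℝ (Fin d) → ℂ} (hv : IsNeumannSolution σ g v) (T : ℝ) :
    ∃ M, 0 ≤ M ∧ ∀ t ∈ Ioc 0 T, ∀ h : EuclideanSpace ℝ (Fin d) → ℂ, ∀ hh : MemLp h 2 volume,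
      ‖pairing (v t) h‖ ≤ M * ‖hh.toLp h‖ := by
  let A : Ioc 0 T → Lp ℂ 2 (volume : Measure (EuclideanSpace ℝ (Fin d))) →L[ℂ] ℂ :=
    fun t => innerSL ℂ ((hv.memLp t t.2.1).toLp (v t))
  have hA : ∀ (t : Ioc 0 T) (h : EuclideanSpace ℝ (Fin d) → ℂ) (hh : MemLp h 2 volume),
      ‖A t (hh.toLp h)‖ = ‖pairing (v t) h‖ := fun t h hh => by
    rw [pairing_eq_inner (hv.memLp t t.2.1) hh, ← norm_inner_symm]
    rfl
  obtain ⟨M, hM⟩ := banach_steinhaus (g := A) (fun k => by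
    have hk := Lp.memLp k
    -- With the value `0` at `t = 0`, the weak initial condition makes the pairing continuous on the
    -- compact interval `[0, T]`. This gives the pointwise bounds needed for Banach–Steinhaus.
    have hc : ContinuousOn (Function.update (fun t => pairing (v t) k) 0 0) (Icc 0 T) := by
      intro t ht
      rcases ht.1.eq_or_lt with rfl | h0
      · refine ContinuousWithinAt.mono ?_ Icc_subset_Ici_self
        rw [continuousWithinAt_update_same, Ici_sdiff_left]
        exact hv.initial_value k hk
      · refine ContinuousAt.continuousWithinAt ?_
        rw [continuousAt_update_of_ne h0.ne']
        exact (hv.differentiableAt k hk t h0).1.continuousAt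
    obtain ⟨C, hC⟩ := isCompact_Icc.exists_bound_of_continuousOn hc
    refine ⟨C, fun t => ?_⟩
    have h1 := hC t ⟨t.2.1.le, t.2.2⟩
    rw [Function.update_of_ne t.2.1.ne'] at h1
    rw [← hA t k hk, Lp.toLp_coeFn] at h1
    exact h1)
  refine ⟨max M 0, le_max_right _ _, fun t ht h hh => ?_⟩
  rw [← hA ⟨t, ht⟩ h hh]
  exact (ContinuousLinearMap.le_of_opNorm_le _ ((hM ⟨t, ht⟩).trans (le_max_left _ _)) _)

lemma IsNeumannSolution.eq_zero {σ : ℝ} (hσ : 0 < σ) (hσ1 : σ < 1)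
    {v : ℝ → EuclideanSpace ℝ (Fin d) → ℂ} (hv : IsNeumannSolution σ (fun _ => 0) v) {T : ℝ}
    (hT : 0 < T) (x : EuclideanSpace ℝ (Fin d)) : v T x = 0 := by
  let E := EuclideanSpace ℝ (Fin d)
  let L : Type := Lp ℂ 2 (volume : Measure E)
  let V : L := 𝓕⁻ ((hv.memLp T hT).toLp (v T))
  obtain ⟨M, hM0, hM⟩ := hv.exists_norm_pairing_le T
  have hband : ∀ R : ℕ, ∀ᵐ ξ : E, ξ ∈ Metric.ball (0 : E) R → V ξ = 0 := by
    intro R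
    -- On the frequency side these are `Δ^n` applied to the part of `v T` with frequencies below
    -- `R`. The truncation makes every power of the symbol bounded, by `C ^ n`.
    let k : ℕ → E → ℂ := fun n ξ => laplaceSymbol ξ ^ n * (Metric.ball (0 : E) R).indicator V ξ
    set C : ℝ := (2 * Real.pi) ^ 2 * R ^ 2 with hC
    have hC0 : 0 ≤ C := by positivity
    have hkb : ∀ n ξ, ‖k n ξ‖ ≤ C ^ n * ‖V ξ‖ := by
      intro n ξ
      by_cases hξ : ξ ∈ Metric.ball (0 : E) R
      · have h1 : ‖laplaceSymbol ξ‖ ≤ C := by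
          rw [laplaceSymbol, Complex.norm_real, norm_mul, norm_neg,
            Real.norm_of_nonneg (by positivity), Real.norm_of_nonneg (by positivity), hC]
          gcongr
          simpa using (Metric.mem_ball.1 hξ).le
        simp only [k, indicator_of_mem hξ, norm_mul, norm_pow]
        gcongr
      · simp only [k, indicator_of_notMem hξ, mul_zero, norm_zero]
        positivity
    have hk : ∀ n, MemLp (k n) 2 volume := fun n =>
      (Lp.memLp V).of_le_mul ((continuous_laplaceSymbol.pow n).aestronglyMeasurable.mul
        ((Lp.memLp V).1.indicator measurableSet_ball)) (.of_forall (hkb n))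
    let H : ℕ → L := fun n => 𝓕 ((hk n).toLp (k n))
    have hpair : ∀ n {f : E → ℂ} (hf : MemLp f 2 volume), pairing f (H n) =
        ∫ ξ, (𝓕⁻ (hf.toLp f) : L) ξ * (starRingEnd ℂ) (k n ξ) := by
      intro n f hf
      rw [pairing_eq_inner hf (Lp.memLp (H n)), Lp.toLp_coeFn,
        ← FourierTransform.fourier_fourierInv_eq (E := L) (F := L) (hf.toLp f),
        Lp.inner_fourier_eq, L2.inner_def,
        FourierTransform.fourier_fourierInv_eq]
      refine integral_congr_ae ?_
      filter_upwards [(hk n).coeFn_toLp] with ξ hξ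
      rw [hξ]
      simp
    let F : ℕ → ℝ → ℂ := fun n t => pairing (v t) (H n)
    have hH := fun n => Lp.memLp (H n)
    have hF0 : F 0 T = 0 := by
      refine eq_zero_of_hierarchy (D := M * ‖V‖) hσ1 hC0 (by positivity)
        (fun n t ht => (hv.differentiableAt _ (hH n) t ht).1)
        (fun n t ht => (hv.differentiableAt _ (hH n) t ht).2)
        (fun n => hv.initial_value _ (hH n)) (fun n => ?_) (fun n t ht => ?_) (fun n t ht => ?_)
        (right_mem_Ioc.2 hT)
      · have h1 := (hv.initial_derivative _ (hH n)).const_mul (2 * σ : ℂ)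
        rw [show pairing (fun _ => 0) (H n) = 0 by simp [pairing], mul_zero] at h1
        refine h1.congr fun t => ?_
        have : (σ : ℂ) ≠ 0 := by exact_mod_cast hσ.ne'
        rw [sigmaDeriv]
        push_cast
        field_simp
      -- The symbol is real, so it moves from `w` to the test function and raises `n` by one.
      · obtain ⟨w, hw, e⟩ := hv.equation t ht
        have e1 := e _ (hH n)
        rw [hpair n hw.2.1] at e1
        refine e1.trans ?_
        rw [hpair (n + 1) hw.1]
        refine integral_congr_ae ?_
        filter_upwards [hw.fourierInv_ae_eq] with ξ hξ
        have hs : (starRingEnd ℂ) (laplaceSymbol ξ) = laplaceSymbol ξ := Complex.conj_ofReal _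
        rw [hξ]
        simp only [k, map_mul, map_pow, hs]
        ring
      · refine (hM t ht _ (hH n)).trans ?_
        rw [Lp.toLp_coeFn, Lp.norm_fourier_eq, mul_assoc, mul_comm ‖V‖]
        gcongr
        refine Lp.norm_le_mul_norm_of_ae_le_mul ?_
        filter_upwards [(hk n).coeFn_toLp] with ξ hξ
        rw [hξ]
        exact hkb n ξ
    -- Since the test function was cut out of `V` itself, `F 0 T` is the squared `L²` norm of `V` on
    -- the ball.
    have hself : ⟪(hk 0).toLp (k 0), (hk 0).toLp (k 0)⟫_ℂ = 0 := by
      rw [← hF0]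
      simp only [F]
      rw [hpair 0 (hv.memLp T hT), L2.inner_def]
      refine integral_congr_ae ?_
      filter_upwards [(hk 0).coeFn_toLp] with ξ hξ
      rw [hξ]
      simp only [k, pow_zero, one_mul, RCLike.inner_apply]
      by_cases hb : ξ ∈ Metric.ball (0 : E) R
      · simp only [indicator_of_mem hb]
        rfl
      · simp only [indicator_of_notMem hb]
        simp
    have hzero := (hk 0).coeFn_toLp
    rw [inner_self_eq_zero.1 hself] at hzero
    filter_upwards [hzero, Lp.coeFn_zero ℂ 2 (volume : Measure E)] with ξ h1 h2 hb
    rw [h2] at h1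
    simpa [k, indicator_of_mem hb] using h1.symm
  have hV : V = 0 := by
    rw [Lp.eq_zero_iff_ae_eq_zero]
    filter_upwards [ae_all_iff.2 hband] with ξ hξ
    obtain ⟨R, hR⟩ := exists_nat_gt ‖ξ‖
    exact hξ R (by simpa using hR)
  have hv0 : (hv.memLp T hT).toLp (v T) = 0 := by
    rw [← FourierTransform.fourier_fourierInv_eq (E := L) (F := L) ((hv.memLp T hT).toLp (v T))]
    change 𝓕 V = 0
    rw [hV, FourierTransform.fourier_zero]
  have hae : v T =ᵐ[volume] fun _ => (0 : ℂ) := by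
    have h1 := (hv.memLp T hT).coeFn_toLp
    rw [hv0] at h1
    exact h1.symm.trans (Lp.coeFn_zero ℂ 2 (volume : Measure E))
  -- Continuity turns vanishing almost everywhere into vanishing at every point.
  exact congrFun (((hv.continuous T hT).ae_eq_iff_eq volume continuous_const).1 hae) x

lemma isTheNeumannSolution_neumannSolution {σ : ℝ} (hσ : σ ∈ Ioo (0 : ℝ) 1)
    (g : 𝓢(EuclideanSpace ℝ (Fin d), ℂ)) :
    IsTheNeumannSolution σ g (neumannSolution g σ) :=
  ⟨isNeumannSolution_neumannSolution g hσ.1, fun _ hv _ ht x =>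
    sub_eq_zero.1 ((hv.sub (isNeumannSolution_neumannSolution g hσ.1)).eq_zero hσ.1 hσ.2 ht x)⟩

end Uniqueness

/-! ### Continuity in `σ` and identification of the limit with a spherical mean. -/

section Limit

open scoped FourierTransform InnerProductSpace

variable {d : ℕ}

/-- The solution depends continuously on `σ ≥ 0`, including the endpoint `σ = 0`. -/
lemma tendsto_neumannSolution (g : 𝓢(EuclideanSpace ℝ (Fin d), ℂ)) {σ₀ t : ℝ} (hσ₀ : 0 ≤ σ₀)
    (ht : 0 < t) (x : EuclideanSpace ℝ (Fin d)) :
    Tendsto (fun σ => neumannSolution g σ t x) (𝓝[Ioi 0] σ₀) (𝓝 (neumannSolution g σ₀ t x)) := by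
  have hpow : Tendsto (fun σ : ℝ => t ^ (2 * σ)) (𝓝[Ioi 0] σ₀) (𝓝 (t ^ (2 * σ₀))) :=
    ((by fun_prop (disch := positivity) : Continuous fun σ : ℝ => t ^ (2 * σ)).tendsto
      σ₀).mono_left nhdsWithin_le_nhds
  -- Near `σ₀` the multiplier is bounded by a constant free of `σ`, so a multiple of `‖𝓕 g‖`
  -- dominates.
  have hev : ∀ᶠ σ in 𝓝[Ioi 0] σ₀, t ^ (2 * σ) < t ^ (2 * σ₀) + 1 :=
    hpow.eventually_lt_const (lt_add_one _)
  simp only [neumannSolution, Real.fourierInv_eq']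
  refine tendsto_integral_filter_of_dominated_convergence
    (fun ξ => (t ^ (2 * σ₀) + 1) * ‖(𝓕 g) ξ‖) ?_ ?_ ((𝓕 g).integrable.norm.const_mul _) ?_
  · filter_upwards [self_mem_nhdsWithin] with σ hσ
    have h1 := continuous_neumannMultiplier (d := d) hσ t
    exact Continuous.aestronglyMeasurable (by fun_prop)
  · filter_upwards [self_mem_nhdsWithin, hev] with σ hσ hσ'
    refine .of_forall fun ξ => ?_
    rw [norm_smul, Complex.norm_exp_ofReal_mul_I, one_mul, norm_mul, Complex.norm_real]
    gcongr
    exact (abs_neumannMultiplier_le hσ ht.le ξ).trans hσ'.le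
  · refine .of_forall fun ξ => ?_
    have hK : Tendsto (fun σ => besselSeries (σ + 1) (Real.pi ^ 2 * ‖ξ‖ ^ 2 * t ^ 2))
        (𝓝[Ioi 0] σ₀) (𝓝 (besselSeries (σ₀ + 1) (Real.pi ^ 2 * ‖ξ‖ ^ 2 * t ^ 2))) := by
      have h1 := continuousOn_besselSeries_index (Real.pi ^ 2 * ‖ξ‖ ^ 2 * t ^ 2) (σ₀ + 1)
        (by simpa using hσ₀)
      refine h1.tendsto.comp (tendsto_nhdsWithin_iff.2 ⟨?_, ?_⟩)
      · exact ((continuous_add_const (1 : ℝ)).tendsto σ₀).mono_left nhdsWithin_le_nhds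
      · filter_upwards [self_mem_nhdsWithin] with σ hσ
        have : (0 : ℝ) < σ := hσ
        exact mem_Ici.2 (by linarith)
    have hm : Tendsto (fun σ => neumannMultiplier σ t ξ) (𝓝[Ioi 0] σ₀)
      (𝓝 (neumannMultiplier σ₀ t ξ)) := hpow.mul hK
    exact (((Complex.continuous_ofReal.tendsto _).comp hm).mul_const _).const_smul _

/-- Fourier representation of spherical means. -/
lemma integral_sphere_schwartz [NeZero d] (g : 𝓢(EuclideanSpace ℝ (Fin d), ℂ)) (t : ℝ)
    (x : EuclideanSpace ℝ (Fin d)) :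
    ∫ ω : Metric.sphere (0 : EuclideanSpace ℝ (Fin d)) 1,
        g (x + t • (ω : EuclideanSpace ℝ (Fin d)))
          ∂(volume : Measure (EuclideanSpace ℝ (Fin d))).toSphere =
      (volume : Measure (EuclideanSpace ℝ (Fin d))).toSphere.real univ *
        (𝓕⁻ fun ξ => (besselSeries (d / 2) (Real.pi ^ 2 * ‖ξ‖ ^ 2 * t ^ 2) : ℂ) * (𝓕 g) ξ) x := by
  let S := (volume : Measure (EuclideanSpace ℝ (Fin d))).toSphere
  have hg : ∀ y, g y = ∫ ξ, Complex.exp (((2 * Real.pi * ⟪ξ, y⟫_ℝ : ℝ) : ℂ) * Complex.I) *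
      (𝓕 g) ξ := fun y => by
    have h1 := congrFun (congrArg (fun φ : 𝓢(EuclideanSpace ℝ (Fin d), ℂ) => (φ : _ → ℂ))
      (FourierTransform.fourierInv_fourier_eq (E := 𝓢(EuclideanSpace ℝ (Fin d), ℂ))
        (F := 𝓢(EuclideanSpace ℝ (Fin d), ℂ)) g)) y
    simp only [SchwartzMap.fourierInv_coe, Real.fourierInv_eq'] at h1
    exact h1.symm
  have hint : Integrable (fun p : Metric.sphere (0 : EuclideanSpace ℝ (Fin d)) 1 ×
      EuclideanSpace ℝ (Fin d) =>
      Complex.exp (((2 * Real.pi * ⟪p.2, x + t • (p.1 : EuclideanSpace ℝ (Fin d))⟫_ℝ : ℝ) : ℂ) *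
        Complex.I) * (𝓕 g) p.2) (S.prod volume) := by
    refine Integrable.bdd_mul (c := 1) ((𝓕 g).integrable.comp_snd S)
      (Continuous.aestronglyMeasurable (by fun_prop)) (.of_forall fun p => ?_)
    rw [Complex.norm_exp_ofReal_mul_I]
  simp only [hg]
  rw [integral_integral_swap hint, Real.fourierInv_eq', ← integral_const_mul]
  refine integral_congr_ae (.of_forall fun ξ => ?_)
  -- With `z = 2πt` the argument `z²‖ξ‖²/4` becomes `π²‖ξ‖²t²`, as in the multiplier.
  have h1 := integral_sphere_exp ξ (2 * Real.pi * t)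
  have h2 : ∀ ω : Metric.sphere (0 : EuclideanSpace ℝ (Fin d)) 1,
      Complex.exp (((2 * Real.pi * ⟪ξ, x + t • (ω : EuclideanSpace ℝ (Fin d))⟫_ℝ : ℝ) : ℂ) *
        Complex.I) * (𝓕 g) ξ =
      Complex.exp (((2 * Real.pi * t * ⟪(ω : EuclideanSpace ℝ (Fin d)), ξ⟫_ℝ : ℝ) : ℂ) *
        Complex.I) *
        (Complex.exp (((2 * Real.pi * ⟪ξ, x⟫_ℝ : ℝ) : ℂ) * Complex.I) * (𝓕 g) ξ) := fun ω => by
    rw [← mul_assoc, ← Complex.exp_add, inner_add_right, inner_smul_right, real_inner_comm ξ]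
    push_cast
    ring_nf
  simp only [h2]
  rw [integral_mul_const, h1, finrank_euclideanSpace, Fintype.card_fin,
    show (2 * Real.pi * t) ^ 2 * ‖ξ‖ ^ 2 / 4 = Real.pi ^ 2 * ‖ξ‖ ^ 2 * t ^ 2 by ring]
  push_cast
  simp only [smul_eq_mul]
  ring

/-- At the critical exponent `σ = d / 2 - 1` the Fourier formula for the solution gives a
spherical mean. -/
lemma neumannSolution_eq_sphereIntegral [NeZero d] (g : 𝓢(EuclideanSpace ℝ (Fin d), ℂ))
    {σ t c : ℝ} (hσ : 2 * σ = d - 2) (ht : 0 < t) (hc : c ≠ 0)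
    (hS : (volume : Measure (EuclideanSpace ℝ (Fin d))).toSphere.real univ = c)
    (x : EuclideanSpace ℝ (Fin d)) :
    neumannSolution g σ t x = ((1 / (c * t) : ℝ) : ℂ) * sphereIntegral g x t := by
  have hm : ∀ ξ : EuclideanSpace ℝ (Fin d), neumannMultiplier σ t ξ =
      t ^ (2 * σ) * besselSeries (d / 2) (Real.pi ^ 2 * ‖ξ‖ ^ 2 * t ^ 2) := fun ξ => by
    rw [neumannMultiplier, timeFactor, show σ + 1 = d / 2 by linarith]
  -- The scaling factor of the sphere exceeds the power `t^{2σ}` in the multiplier by one factor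
  -- `t`, whence the `1/t` in the result.
  have hp : t ^ (d - 1) = t ^ (2 * σ) * t := by
    rw [← Real.rpow_add_one ht.ne', ← Real.rpow_natCast, hσ,
      Nat.cast_sub (Nat.one_le_iff_ne_zero.2 (NeZero.ne d))]
    congr 1
    push_cast
    ring
  rw [sphereIntegral, integral_sphere_schwartz, hS, hp, neumannSolution]
  simp only [hm, Real.fourierInv_eq', smul_eq_mul]
  rw [← integral_const_mul, ← integral_const_mul, ← integral_const_mul]
  refine integral_congr_ae (.of_forall fun ξ => ?_)
  have : (t : ℂ) ≠ 0 := by exact_mod_cast ht.ne'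
  have : (c : ℂ) ≠ 0 := by exact_mod_cast hc
  push_cast
  field_simp

/-- The total mass of the sphere is `d` times the volume of the unit ball; likewise in the next two
dimensions. -/
lemma toSphere_real_univ_two :
    (volume : Measure (EuclideanSpace ℝ (Fin 2))).toSphere.real univ = 2 * Real.pi := by
  rw [Measure.toSphere_real_apply_univ, measureReal_def, EuclideanSpace.volume_ball_fin_two]
  simp [Real.pi_pos.le]

lemma toSphere_real_univ_three :
    (volume : Measure (EuclideanSpace ℝ (Fin 3))).toSphere.real univ = 4 * Real.pi := by
  rw [Measure.toSphere_real_apply_univ, measureReal_def, EuclideanSpace.volume_ball_fin_three,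
    ENNReal.toReal_mul, ENNReal.toReal_ofReal (by positivity)]
  simp
  ring

lemma toSphere_real_univ_four :
    (volume : Measure (EuclideanSpace ℝ (Fin 4))).toSphere.real univ = 2 * Real.pi ^ 2 := by
  rw [Measure.toSphere_real_apply_univ, measureReal_def,
    InnerProductSpace.volume_ball_of_dim_even (k := 2) (by simp),
    ENNReal.toReal_mul, ENNReal.toReal_ofReal (by positivity)]
  simp [Nat.factorial]
  ring

end Limit

end FractionalWave

end

theorem theorem5 :
    (∀ g : 𝓢(EuclideanSpace ℝ (Fin 2), ℂ),
      ∃ u : ℝ → ℝ → EuclideanSpace ℝ (Fin 2) → ℂ,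
        (∀ σ ∈ Ioo (0 : ℝ) 1, FractionalWave.IsTheNeumannSolution σ g (u σ)) ∧
        ∀ t > 0, ∀ x, Tendsto (fun σ => u σ t x) (𝓝[>] 0)
          (𝓝 (((1 / (2 * Real.pi * t) : ℝ) : ℂ) * FractionalWave.sphereIntegral g x t))) ∧
    (∀ g : 𝓢(EuclideanSpace ℝ (Fin 3), ℂ),
      ∃ u : ℝ → ℝ → EuclideanSpace ℝ (Fin 3) → ℂ,
        (∀ σ ∈ Ioo (0 : ℝ) 1, FractionalWave.IsTheNeumannSolution σ g (u σ)) ∧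
        ∀ t > 0, ∀ x, Tendsto (fun σ => u σ t x) (𝓝[≠] (1 / 2))
          (𝓝 (((1 / (4 * Real.pi * t) : ℝ) : ℂ) * FractionalWave.sphereIntegral g x t))) ∧
    (∀ g : 𝓢(EuclideanSpace ℝ (Fin 4), ℂ),
      ∃ u : ℝ → ℝ → EuclideanSpace ℝ (Fin 4) → ℂ,
        (∀ σ ∈ Ioo (0 : ℝ) 1, FractionalWave.IsTheNeumannSolution σ g (u σ)) ∧
        ∀ t > 0, ∀ x, Tendsto (fun σ => u σ t x) (𝓝[<] 1)
          (𝓝 (((1 / (2 * Real.pi ^ 2 * t) : ℝ) : ℂ) * FractionalWave.sphereIntegral g x t))) := by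
  -- For `a > 0` the half-line is a neighbourhood of `a`, so the limit within it yields the
  -- punctured limit at `1/2` and the left limit at `1`. For `d = 2` it is already the right limit
  -- at `0`.
  have hIoi : ∀ {a : ℝ}, 0 < a → ∀ s : Set ℝ, 𝓝[s] a ≤ 𝓝[Ioi 0] a := fun ha s => by
    rw [nhdsWithin_eq_nhds.2 (Ioi_mem_nhds ha)]
    exact nhdsWithin_le_nhds
  have hpi := Real.pi_pos
  refine ⟨fun g => ⟨FractionalWave.neumannSolution g,
      fun σ hσ => FractionalWave.isTheNeumannSolution_neumannSolution hσ g, fun t ht x => ?_⟩,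
    fun g => ⟨FractionalWave.neumannSolution g,
      fun σ hσ => FractionalWave.isTheNeumannSolution_neumannSolution hσ g, fun t ht x => ?_⟩,
    fun g => ⟨FractionalWave.neumannSolution g,
      fun σ hσ => FractionalWave.isTheNeumannSolution_neumannSolution hσ g, fun t ht x => ?_⟩⟩
  · rw [← FractionalWave.neumannSolution_eq_sphereIntegral g (σ := 0) (by norm_num) ht
      (by positivity) FractionalWave.toSphere_real_univ_two]
    exact FractionalWave.tendsto_neumannSolution g le_rfl ht x
  · rw [← FractionalWave.neumannSolution_eq_sphereIntegral g (σ := 1 / 2) (by norm_num) ht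
      (by positivity) FractionalWave.toSphere_real_univ_three]
    exact (FractionalWave.tendsto_neumannSolution g (by norm_num) ht x).mono_left
      (hIoi (by norm_num) _)
  · rw [← FractionalWave.neumannSolution_eq_sphereIntegral g (σ := 1) (by norm_num) ht
      (by positivity) FractionalWave.toSphere_real_univ_four]
    exact (FractionalWave.tendsto_neumannSolution g zero_le_one ht x).mono_left
      (hIoi one_pos _)
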